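/- Let $1\le d\le n$, let $v\in\mathbb{R}^d$ and $w_1,\dots,w_n\in\mathbb{R}^d$, and let $K=\{v+\sum_i t_iw_i : t_i\ge 0\}$ be the polyhedral cone with apex $v$ and generators $w_1,\dots,w_n$. Assume that $K$ contains no line and that no $d$ of the generators are linearly dependent. A *diagonal* of $K$ is a $(d-1)$-element set $D=\{w_{i_1},\dots,w_{i_{d-1}}\}$, $i_1<\dots<i_{d-1}$, of generators. It is *extremal* if the cone $\{v+\sum_k t_kw_{i_k}: t_k\ge0\}$ is contained in the boundary of $K$, and *interior* otherwise. Write $\det(D,x)=\det(w_{i_1},\dots,w_{i_{d-1}},x)$, and let $D^*\in\mathbb{R}^d$ be the generalized cross product of $w_{i_1},\dots,w_{i_{d-1}}$, i.e. the vector with $\langle D^*,x\rangle=\det(D,x)$ for all $x\in\mathbb{R}^d$. For $\xi\in\mathbb{R}^d$ let $\nu_{n-d}(\xi)$ be the vector of all monomials $\xi^E$ of degree $n-d$. The interpolation matrix $A_K$ is the real matrix with one row for each diagonal $D$, namely $\nu_{n-d}(D^*)$. Then: (1) $K$ is a cone with apex $v$ over a simplicial polytope of dimension $d-1$ (whose affine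 hull does not contain $v$). (2) $A_K$ is an $\binom{n}{d-1}\times\binom{n-1}{d-1}$ matrix and has full rank: $\operatorname{rank}A_K=\binom{n-1}{d-1}$. (3) There is exactly one real homogeneous polynomial $p_K$ of degree $n-d$ such that, for every $\zeta\in\mathbb{C}^d$ with $\langle w_i,\operatorname{Im}\zeta\rangle>0$ for all $i$, the integral below converges absolutely and $$\hat 1_K(\zeta)=\int_K e^{2\pi i\langle x,\zeta\rangle}\,dx=\Big(\frac{i}{2\pi}\Big)^{d}\,\frac{p_K(\zeta)}{\prod_{j=1}^n\langle w_j,\zeta\rangle}\,e^{2\pi i\langle v,\zeta\rangle},\qquad \langle x,\zeta\rangle=\sum_k x_k\zeta_k .$$ (4) For every extremal diagonal $D$ the number $\varepsilon_D\prod_{w_j\notin D}\det(D,w_j)$ is the same whichever $\det(D,w_j)$ with $w_j\notin D$ is chosen to define $\varepsilon_D$ as its sign. Let $b_K$ be the vector indexed by the diagonals with this entry at an extremal $D$ and with entry $0$ at an interior $D$. The linear system $A_Kx=b_K$ has exactly one solution, namely the vector of coefficients of $p_K$. Equivalently, $p_K$ is the only homogeneous polynomial of degree $n-d$ with $p_K(D^*)=(b_K)_D$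 for all diagonals $D$. Thus the conic Fourier transform $\hat 1_K$ is determined by these values. -/

import Mathlib

open scoped Matrix

noncomputable section

namespace ConicFourier

variable {d n : ℕ}

/-- The polyhedral cone `{v + t₁ w₁ + ⋯ + tₙ wₙ : tᵢ ≥ 0}` with apex `v` and generators `w`. -/
def cone (v : Fin d → ℝ) (w : Fin n → Fin d → ℝ) : Set (Fin d → ℝ) :=
  {x | ∃ t : Fin n → ℝ, (∀ i, 0 ≤ t i) ∧ x = v + ∑ i, t i • w i}

/-- A set that contains no (affine) line. -/
def ContainsNoLine (K : Set (Fin d → ℝ)) : Prop :=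
  ¬ ∃ x u : Fin d → ℝ, u ≠ 0 ∧ ∀ t : ℝ, x + t • u ∈ K

/-- No `d` of the vectors `w₁, …, wₙ` of `ℝ^d` are linearly dependent. -/
def GeneralPosition (w : Fin n → Fin d → ℝ) : Prop :=
  ∀ s : Finset (Fin n), s.card = d → LinearIndependent ℝ (fun i : s => w i)

/-- `P` is a convex polytope of dimension `k` all of whose proper faces are simplices. -/
def IsSimplicialPolytope (k : ℕ) (P : Set (Fin d → ℝ)) : Prop :=
  P.Nonempty ∧ (∃ T : Finset (Fin d → ℝ), P = convexHull ℝ (T : Set (Fin d → ℝ))) ∧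
  Module.finrank ℝ (vectorSpan ℝ P) = k ∧
  ∀ F : Set (Fin d → ℝ), IsExposed ℝ P F → F ≠ P →
    ∃ T : Finset (Fin d → ℝ),
      AffineIndependent ℝ (fun x : T => (x : Fin d → ℝ)) ∧
      F = convexHull ℝ (T : Set (Fin d → ℝ))

/-- `K` is the cone with apex `v` over a simplicial polytope of dimension `d - 1`
whose affine hull does not contain `v`. -/
def IsConeOverSimplicialPolytope (v : Fin d → ℝ) (K : Set (Fin d → ℝ)) : Prop :=
  ∃ P : Set (Fin d → ℝ), IsSimplicialPolytope (d - 1) P ∧ v ∉ affineSpan ℝ P ∧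
    K = {x | ∃ t : ℝ, 0 ≤ t ∧ ∃ y ∈ P, x = v + t • (y - v)}

/-- `det (x₁, …, x_{d-1}, y)`: the vectors are the rows of the matrix, `y` being the last one. -/
def detWith (x : Fin (d - 1) → Fin d → ℝ) (y : Fin d → ℝ) : ℝ :=
  Matrix.det (Matrix.of fun k : Fin d => if h : (k : ℕ) < d - 1 then x ⟨k, h⟩ else y)

/-- The generalized cross product `[x₁, …, x_{d-1}]`, the vector that represents the linear
functional `y ↦ det (x₁, …, x_{d-1}, y)`; see `crossProduct_dotProduct`. -/
def crossProduct (x : Fin (d - 1) → Fin d → ℝ) : Fin d → ℝ :=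
  fun k => detWith x (Pi.single k 1)

theorem crossProduct_dotProduct (hd : 1 ≤ d) (x : Fin (d - 1) → Fin d → ℝ) (y : Fin d → ℝ) :
    crossProduct x ⬝ᵥ y = detWith x y := by
  obtain ⟨m, rfl⟩ : ∃ m, d = m + 1 := ⟨d - 1, by omega⟩
  have key : ∀ z : Fin (m + 1) → ℝ, detWith x z =
      Matrix.detRowAlternating (R := ℝ) (Function.update
        (fun k : Fin (m + 1) => if h : (k : ℕ) < m + 1 - 1 then x ⟨k, h⟩ else 0)
        (Fin.last m) z) := by
    intro z
    unfold detWith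
    change Matrix.det _ = Matrix.det _
    congr 1
    ext i j
    by_cases hi : i = Fin.last m
    · subst hi
      simp
    · have : (i : ℕ) < m + 1 - 1 := by
        have h1 := i.2
        have h2 : (i : ℕ) ≠ m := fun h => hi (Fin.ext (by simpa using h))
        omega
      have h3 : (i : ℕ) < m := this
      simp [Function.update_of_ne hi, h3]
  have lin : ∀ z : Fin (m + 1) → ℝ, detWith x z =
      (Matrix.detRowAlternating (n := Fin (m + 1)) (R := ℝ)).toMultilinearMap.toLinearMap
        (fun k : Fin (m + 1) => if h : (k : ℕ) < m + 1 - 1 then x ⟨k, h⟩ else 0)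
        (Fin.last m) z := by
    intro z
    rw [key z]
    rfl
  conv_rhs => rw [lin y, LinearMap.pi_apply_eq_sum_univ]
  simp only [dotProduct, crossProduct, lin, smul_eq_mul]
  refine Finset.sum_congr rfl fun k _ => ?_
  rw [mul_comm]
  congr 2
  ext j
  simp [Pi.single_apply, eq_comm]

/-- The diagonals: `(d - 1)`-element subsets of the set of generators (given by their indices). -/
abbrev Diagonal (d n : ℕ) : Type := {D : Finset (Fin n) // D.card = d - 1}

/-- The generators of a diagonal, listed by increasing index. -/
def Diagonal.vectors (w : Fin n → Fin d → ℝ) (D : Diagonal d n) : Fin (d - 1) → Fin d → ℝ :=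
  fun k => w (D.1.orderEmbOfFin D.2 k)

/-- The vector `D*` of a diagonal `D`. -/
def Diagonal.dual (w : Fin n → Fin d → ℝ) (D : Diagonal d n) : Fin d → ℝ :=
  crossProduct (D.vectors w)

/-- The diagonal `D` of the cone with apex `v` and generators `w` is extremal: the cone with
apex `v` that it spans lies in the boundary of the whole cone. A diagonal that is not extremal
is called interior. -/
def Diagonal.IsExtremal (v : Fin d → ℝ) (w : Fin n → Fin d → ℝ) (D : Diagonal d n) : Prop :=
  cone v (D.vectors w) ⊆ frontier (cone v w)

/-- The exponents `(e₁, …, e_d)` of the monomials of degree `k` in `d` variables. -/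
abbrev Exponent (d k : ℕ) : Type :=
  {e : Fin d →₀ ℕ // e ∈ Finset.finsuppAntidiag (Finset.univ : Finset (Fin d)) k}

/-- The Veronese map `ν_k`: all monomials of degree `k`, evaluated at a point. -/
def veronese (k : ℕ) (ξ : Fin d → ℝ) : Exponent d k → ℝ :=
  fun e => ∏ i, ξ i ^ e.1 i

/-- The interpolation matrix `A_K`; its row at the diagonal `D` is `ν_{n-d}(D*)`. -/
def interpolationMatrix (w : Fin n → Fin d → ℝ) :
    Matrix (Diagonal d n) (Exponent d (n - d)) ℝ :=
  Matrix.of fun D => veronese (n - d) (D.dual w)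

/-- `b` is the right-hand side `b_K` of the interpolation system. At an extremal diagonal `D`
it is `ε ∏_{j ∉ D} det (D, w_j)`, with `ε` the sign of any one of these determinants, and at
an interior diagonal it is `0`. -/
def IsInterpolationData (v : Fin d → ℝ) (w : Fin n → Fin d → ℝ) (b : Diagonal d n → ℝ) : Prop :=
  ∀ D : Diagonal d n,
    (D.IsExtremal v w → ∀ j ∉ D.1,
      b D = (SignType.sign (detWith (D.vectors w) (w j)) : ℝ) *
        ∏ i ∈ D.1ᶜ, detWith (D.vectors w) (w i)) ∧
    (¬ D.IsExtremal v w → b D = 0)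

/-- The bilinear pairing `⟨x, ζ⟩ = ∑ x_k ζ_k` of a real with a complex vector. -/
def pairing (x : Fin d → ℝ) (ζ : Fin d → ℂ) : ℂ := ∑ k, (x k : ℂ) * ζ k

/-- The tube domain of all `ζ` with `⟨w_i, Im ζ⟩ > 0` for every generator `w_i`, on which the
integral that defines the Fourier transform of the cone converges. -/
def tube (w : Fin n → Fin d → ℝ) : Set (Fin d → ℂ) := {ζ | ∀ i, 0 < (pairing (w i) ζ).im}

/-- The integrand `x ↦ exp (2πi ⟨x, ζ⟩)` of the Fourier transform. -/
def character (ζ : Fin d → ℂ) (x : Fin d → ℝ) : ℂ :=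
  Complex.exp (2 * Real.pi * Complex.I * pairing x ζ)

/-- The Fourier transform `∫_K exp (2πi ⟨x, ζ⟩) dx` of the indicator function of `K`. -/
def fourierIndicator (K : Set (Fin d → ℝ)) (ζ : Fin d → ℂ) : ℂ := ∫ x in K, character ζ x

/-- `p` is the numerator `p_K` of the Fourier transform of the cone `K`: a homogeneous polynomial
of degree `n - d` for which the Fourier transform equals
`(i / 2π)^d · p(ζ) / ∏ ⟨w_i, ζ⟩ · exp (2πi ⟨v, ζ⟩)`
where the defining integral converges, and so is given by this formula elsewhere by meromorphic
continuation. For `n = d` it is the constant `|det (w₁, …, w_d)|`. -/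
def IsFourierNumerator (v : Fin d → ℝ) (w : Fin n → Fin d → ℝ)
    (p : MvPolynomial (Fin d) ℝ) : Prop :=
  p.IsHomogeneous (n - d) ∧
  ∀ ζ ∈ tube w, MeasureTheory.IntegrableOn (character ζ) (cone v w) ∧
    fourierIndicator (cone v w) ζ =
      (Complex.I / (2 * Real.pi)) ^ d *
        (MvPolynomial.aeval ζ p / ∏ i, pairing (w i) ζ) * character ζ v

end ConicFourier

end

/-! A generic height `h` on the generators induces a regular triangulation of the cone into
simplicial cones. On a simplicial cone the Fourier integral is a determinant times a product of
one-variable exponential integrals. Summing over the cells and using the common denominator `∏ ⟨w_i,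
ζ⟩` gives a numerator: the sum over cells `T` of `|det T| ∏_{i ∉ T} ⟨w_i, ·⟩`
(`isFourierNumerator_numerator`). It is unique because a polynomial is determined by its values on
the open dual cone.

At `D*` the form of every generator in `D` vanishes, so only cells `D ∪ {k}` contribute, each with
`sign det(D, w_k)` times the full product over `j ∉ D`. The functionals that equal `h` on `D` form a
line of direction `D*`, and the inequalities at the other generators cut out an interval of it,
whose ends are exactly these cells (`isRegularCell_insert_iff`). By `Diagonal.isExtremal_iff`,
extremality means that all `det(D, w_j)` have one sign off `D`: the interval is then a half-line,
with one end of that sign. Otherwise there are either no ends or two of opposite signs, and the sum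
is 0 (`isInterpolationData_numerator`).

The interpolation problem is unisolvent because the diagonals avoiding one fixed generator are as
many as the monomials, and products of linear forms are a Lagrange basis for them
(`interpolationMatrix_injective`). The simplicial polytope is a hyperplane section of the cone: `d`
generators already span, so a proper face cannot contain `d` of the section points. -/

noncomputable section

namespace ConicFourier

variable {d n : ℕ}

/-! ### Linear algebra of generators in general position -/

section Basis

variable {w : Fin n → Fin d → ℝ}

theorem sum_smul_eq_sum_subtype {c : Fin n → ℝ} {T : Finset (Fin n)} (hc : ∀ i ∉ T, c i = 0) :
    ∑ i, c i • w i = ∑ i : T, c i • w i := by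
  rw [Finset.sum_coe_sort T (fun i => c i • w i)]
  exact (Finset.sum_subset (Finset.subset_univ T) fun i _ hi => by simp [hc i hi]).symm

/-- Subsets with at most `d` elements are linearly independent as well. -/
theorem GeneralPosition.eq_zero_of_sum (hgen : GeneralPosition w) (hn : d ≤ n) {c : Fin n → ℝ}
    {S : Finset (Fin n)} (hS : S.card ≤ d) (hc : ∀ i ∉ S, c i = 0)
    (h : ∑ i, c i • w i = 0) : c = 0 := by
  obtain ⟨T, hST, hT⟩ := Finset.exists_superset_card_eq hS (by simpa using hn)
  have hcT : ∀ i ∉ T, c i = 0 := fun i hi => hc i fun h' => hi (hST h')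
  rw [sum_smul_eq_sum_subtype hcT] at h
  have := Fintype.linearIndependent_iff.1 (hgen T hT) (fun i => c i) h
  funext i
  by_cases hi : i ∈ T
  · exact this ⟨i, hi⟩
  · exact hcT i hi

theorem GeneralPosition.span_eq_top (hgen : GeneralPosition w) {T : Finset (Fin n)}
    (hT : T.card = d) : Submodule.span ℝ (Set.range fun i : T => w i) = ⊤ :=
  (hgen T hT).span_eq_top_of_card_eq_finrank' (by simp [hT])

theorem GeneralPosition.exists_sum_eq (hgen : GeneralPosition w) {T : Finset (Fin n)}
    (hT : T.card = d) (x : Fin d → ℝ) :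
    ∃ c : Fin n → ℝ, (∀ i ∉ T, c i = 0) ∧ ∑ i, c i • w i = x := by
  have hx : x ∈ Submodule.span ℝ (Set.range fun i : T => w i) := by
    rw [hgen.span_eq_top hT]; trivial
  obtain ⟨c, hc⟩ := (Submodule.mem_span_range_iff_exists_fun ℝ).1 hx
  have h0 : ∀ i ∉ T, (fun i => if h : i ∈ T then c ⟨i, h⟩ else 0) i = 0 := by
    intro i hi
    simp [hi]
  refine ⟨fun i => if h : i ∈ T then c ⟨i, h⟩ else 0, h0, ?_⟩
  rw [sum_smul_eq_sum_subtype h0, ← hc]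
  simp

theorem dotProduct_sum_smul (l : Fin d → ℝ) (c : Fin n → ℝ) :
    l ⬝ᵥ ∑ i, c i • w i = ∑ i, c i * (l ⬝ᵥ w i) := by
  simp [dotProduct_sum, dotProduct_smul]

theorem GeneralPosition.eq_zero_of_dotProduct (hgen : GeneralPosition w) {T : Finset (Fin n)}
    (hT : T.card = d) {l : Fin d → ℝ} (hl : ∀ i ∈ T, l ⬝ᵥ w i = 0) : l = 0 := by
  obtain ⟨c, hc, hcl⟩ := hgen.exists_sum_eq hT l
  apply dotProduct_self_eq_zero.1
  nth_rw 2 [← hcl]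
  rw [dotProduct_sum_smul]
  refine Finset.sum_eq_zero fun i _ => ?_
  by_cases hi : i ∈ T
  · simp [hl i hi]
  · simp [hc i hi]

theorem GeneralPosition.exists_dotProduct_eq (hgen : GeneralPosition w) {T : Finset (Fin n)}
    (hT : T.card = d) (h : Fin n → ℝ) : ∃ l : Fin d → ℝ, ∀ i ∈ T, l ⬝ᵥ w i = h i := by
  let f : (Fin d → ℝ) →ₗ[ℝ] (T → ℝ) := LinearMap.pi fun i => (dotProductBilin ℝ ℝ).flip (w i)
  have hf : ∀ l i, f l i = l ⬝ᵥ w i := fun l i => rfl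
  have hinj : Function.Injective f := by
    rw [injective_iff_map_eq_zero]
    intro l hl
    exact hgen.eq_zero_of_dotProduct hT fun i hi => by rw [← hf l ⟨i, hi⟩, hl]; rfl
  have hsurj : Function.Surjective f :=
    (LinearMap.injective_iff_surjective_of_finrank_eq_finrank (by simp [hT])).1 hinj
  obtain ⟨l, hl⟩ := hsurj fun i => h i
  exact ⟨l, fun i hi => by rw [← hf l ⟨i, hi⟩, hl]⟩

theorem GeneralPosition.ne_zero (hgen : GeneralPosition w) (hd : 1 ≤ d) (hn : d ≤ n) (i : Fin n) :
    w i ≠ 0 := by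
  intro hi
  have := hgen.eq_zero_of_sum hn (S := {i}) (c := Pi.single i 1) (by simpa using hd)
    (fun j hj => by simp at hj; simp [hj]) (by
      rw [Finset.sum_eq_single i] <;> simp +contextual [hi])
  simpa using congrFun this i

end Basis

/-! ### The vectors `D*` of the diagonals -/

section Diagonal

variable (w : Fin n → Fin d → ℝ)

/-- The indices of a diagonal by increasing order, followed by one more index. -/
def Diagonal.append (D : Diagonal d n) (j : Fin n) (k : Fin d) : Fin n :=
  if h : (k : ℕ) < d - 1 then D.1.orderEmbOfFin D.2 ⟨k, h⟩ else j

theorem Diagonal.dual_dotProduct (hd : 1 ≤ d) (D : Diagonal d n) (x : Fin d → ℝ) :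
    D.dual w ⬝ᵥ x = detWith (D.vectors w) x :=
  crossProduct_dotProduct hd _ _

theorem Diagonal.dual_dotProduct_generator (hd : 1 ≤ d) (D : Diagonal d n) (j : Fin n) :
    D.dual w ⬝ᵥ w j = Matrix.det (Matrix.of fun k => w (D.append j k)) := by
  rw [D.dual_dotProduct w hd, detWith]
  congr 2
  funext k
  unfold append
  split_ifs <;> rfl

theorem Diagonal.append_injective (D : Diagonal d n) {j : Fin n} (hj : j ∉ D.1) :
    Function.Injective (D.append j) := by
  intro a b hab
  unfold append at hab
  have hmem := D.1.orderEmbOfFin_mem D.2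
  split_ifs at hab with ha hb hb
  · have := (D.1.orderEmbOfFin D.2).injective hab
    ext
    simpa using this
  · exact absurd (hab ▸ hmem _) hj
  · exact absurd (hab ▸ hmem _) hj
  · ext
    omega

theorem Diagonal.image_append (hd : 1 ≤ d) (D : Diagonal d n) (j : Fin n) :
    Finset.univ.image (D.append j) = insert j D.1 := by
  ext i
  simp only [Finset.mem_image, Finset.mem_univ, true_and, Finset.mem_insert]
  constructor
  · rintro ⟨k, rfl⟩
    unfold append
    split_ifs with h
    · exact Or.inr (D.1.orderEmbOfFin_mem D.2 _)
    · exact Or.inl rfl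
  · rintro (rfl | hi)
    · exact ⟨⟨d - 1, by omega⟩, by simp [append]⟩
    · have : i ∈ Set.range (D.1.orderEmbOfFin D.2) := by simpa using hi
      obtain ⟨k, rfl⟩ := this
      exact ⟨⟨k, by omega⟩, by simp [append]⟩

theorem Diagonal.dual_dotProduct_mem (hd : 1 ≤ d) (D : Diagonal d n) {j : Fin n} (hj : j ∈ D.1) :
    D.dual w ⬝ᵥ w j = 0 := by
  have : j ∈ Set.range (D.1.orderEmbOfFin D.2) := by simpa using hj
  obtain ⟨k, hk⟩ := this
  rw [D.dual_dotProduct_generator w hd]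
  have hne : (⟨k, by omega⟩ : Fin d) ≠ ⟨d - 1, by omega⟩ := fun h => by
    have := Fin.mk.inj_iff.1 h
    omega
  refine Matrix.det_zero_of_row_eq hne ?_
  change w (D.append j _) = w (D.append j _)
  simp [append, hk]

theorem linearIndependent_comp_of_injective {w : Fin n → Fin d → ℝ} (hgen : GeneralPosition w)
    {f : Fin d → Fin n} (hf : Function.Injective f) : LinearIndependent ℝ fun k => w (f k) := by
  have := hgen (Finset.univ.image f) (by rw [Finset.card_image_of_injective _ hf]; simp)
  exact this.comp (fun k => ⟨f k, by simp⟩) fun a b hab => hf (by simpa using hab)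

theorem det_ne_zero {w : Fin n → Fin d → ℝ} (hgen : GeneralPosition w)
    {f : Fin d → Fin n} (hf : Function.Injective f) :
    Matrix.det (Matrix.of fun k => w (f k)) ≠ 0 := by
  have h := linearIndependent_comp_of_injective hgen hf
  have := (Matrix.linearIndependent_rows_iff_isUnit (A := Matrix.of fun k => w (f k))).1 h
  exact ((Matrix.isUnit_iff_isUnit_det _).1 this).ne_zero

variable {w}

theorem Diagonal.dual_dotProduct_ne_zero (hgen : GeneralPosition w) (hd : 1 ≤ d)
    (D : Diagonal d n) {j : Fin n} (hj : j ∉ D.1) : D.dual w ⬝ᵥ w j ≠ 0 := by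
  rw [D.dual_dotProduct_generator w hd]
  exact det_ne_zero hgen (D.append_injective hj)

theorem Diagonal.exists_notMem (hd : 1 ≤ d) (hn : d ≤ n) (D : Diagonal d n) : ∃ j, j ∉ D.1 := by
  by_contra! h
  have := D.2
  rw [Finset.eq_univ_of_forall h] at this
  simp at this
  omega

theorem Diagonal.card_insert (hd : 1 ≤ d) (D : Diagonal d n) {j : Fin n} (hj : j ∉ D.1) :
    (insert j D.1).card = d := by
  rw [Finset.card_insert_of_notMem hj, D.2]
  omega

/-- The scalar is fixed by one generator `j` outside `D`; since `D ∪ {j}` is a basis, agreement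
there is equality. -/
theorem Diagonal.eq_smul_dual (hgen : GeneralPosition w) (hd : 1 ≤ d) (hn : d ≤ n)
    (D : Diagonal d n) {l : Fin d → ℝ} (hl : ∀ i ∈ D.1, l ⬝ᵥ w i = 0) :
    ∃ c : ℝ, l = c • D.dual w := by
  obtain ⟨j, hj⟩ := D.exists_notMem hd hn
  have hne := D.dual_dotProduct_ne_zero hgen hd hj
  refine ⟨(l ⬝ᵥ w j) / (D.dual w ⬝ᵥ w j), ?_⟩
  rw [← sub_eq_zero]
  refine hgen.eq_zero_of_dotProduct (D.card_insert hd hj) fun i hi => ?_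
  rw [sub_dotProduct, smul_dotProduct, smul_eq_mul]
  rcases Finset.mem_insert.1 hi with rfl | hi
  · field_simp
    simp
  · simp [hl i hi, D.dual_dotProduct_mem w hd hi]

end Diagonal

/-! ### Unisolvence of the interpolation problem -/

section Interpolation

open MvPolynomial

theorem mem_exponent_iff {k : ℕ} {e : Fin d →₀ ℕ} :
    e ∈ Finset.finsuppAntidiag (Finset.univ : Finset (Fin d)) k ↔ ∑ i, e i = k := by
  simp [Finset.mem_finsuppAntidiag]

theorem eval_eq_sum_veronese {k : ℕ} {q : MvPolynomial (Fin d) ℝ} (hq : q.IsHomogeneous k)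
    (ξ : Fin d → ℝ) : eval ξ q = ∑ e : Exponent d k, veronese k ξ e * q.coeff e.1 := by
  rw [eval_eq']
  unfold veronese
  rw [Finset.sum_coe_sort (Finset.finsuppAntidiag (Finset.univ : Finset (Fin d)) k)
    (fun e => (∏ i, ξ i ^ e i) * q.coeff e)]
  simp only [mul_comm]
  refine Finset.sum_subset (fun e he => ?_) fun e _ he => by simp [notMem_support_iff.1 he]
  have := hq (mem_support_iff.1 he)
  rw [Finsupp.weight_apply, Finsupp.sum_fintype _ _ (by simp)] at this
  exact mem_exponent_iff.2 (by simpa using this)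

/-- The rows are evaluation functionals, so the linear system is interpolation of forms at the
points `D*`. -/
theorem interpolationMatrix_mulVec_coeff (w : Fin n → Fin d → ℝ) {q : MvPolynomial (Fin d) ℝ}
    (hq : q.IsHomogeneous (n - d)) (D : Diagonal d n) :
    (interpolationMatrix w).mulVec (fun e => q.coeff e.1) D = eval (D.dual w) q :=
  (eval_eq_sum_veronese hq _).symm

/-- The linear form `ξ ↦ ⟨u, ξ⟩` as a polynomial. -/
def linearForm (u : Fin d → ℝ) : MvPolynomial (Fin d) ℝ := ∑ k, C (u k) * X k

theorem linearForm_isHomogeneous (u : Fin d → ℝ) : (linearForm u).IsHomogeneous 1 :=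
  IsHomogeneous.sum _ _ _ fun k _ => by
    simpa using (isHomogeneous_C _ (u k)).mul (isHomogeneous_X ℝ k)

theorem eval_linearForm (u ξ : Fin d → ℝ) : eval ξ (linearForm u) = ξ ⬝ᵥ u := by
  simp [linearForm, dotProduct, mul_comm]

theorem aeval_linearForm (u : Fin d → ℝ) (ζ : Fin d → ℂ) :
    aeval ζ (linearForm u) = pairing u ζ := by
  simp [linearForm, pairing]

theorem prod_linearForm_isHomogeneous (w : Fin n → Fin d → ℝ) (S : Finset (Fin n)) :
    (∏ i ∈ S, linearForm (w i)).IsHomogeneous S.card := by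
  simpa using IsHomogeneous.prod S (fun i => linearForm (w i)) (fun _ => 1)
    fun i _ => linearForm_isHomogeneous _

theorem card_diagonal : Fintype.card (Diagonal d n) = n.choose (d - 1) := by
  simp [Diagonal]

theorem card_exponent (hd : 1 ≤ d) (hn : d ≤ n) :
    Fintype.card (Exponent d (n - d)) = (n - 1).choose (d - 1) := by
  rw [Fintype.card_coe, Finset.card_finsuppAntidiag_nat_eq_choose]
  simp only [Finset.card_univ, Fintype.card_fin]
  rw [show d + (n - d) - 1 = n - 1 by omega]
  exact (Nat.choose_symm_of_eq_add (by omega))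

variable {w : Fin n → Fin d → ℝ}

/-- The rows of diagonals avoiding `j₀` suffice. For such a `D`, the product of the forms of the
generators outside `D ∪ {j₀}` is nonzero at `D*`. It vanishes at `E*` for any other such `E`,
because `E` has an element outside `D` that is not `j₀`. Hence this square submatrix is surjective,
so injective. -/
theorem interpolationMatrix_injective (hgen : GeneralPosition w) (hd : 1 ≤ d) (hn : d ≤ n) :
    Function.Injective (interpolationMatrix w).mulVec := by
  let j₀ : Fin n := ⟨0, by omega⟩
  let I := {D : Finset (Fin n) // D ∈ Finset.powersetCard (d - 1) (Finset.univ.erase j₀)}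
  have hI : ∀ D : I, j₀ ∉ D.1 ∧ D.1.card = d - 1 := fun D => by
    have := Finset.mem_powersetCard.1 D.2
    exact ⟨fun h => by simpa using this.1 h, this.2⟩
  let f : (Exponent d (n - d) → ℝ) →ₗ[ℝ] (I → ℝ) :=
    (LinearMap.funLeft ℝ ℝ fun D : I => (⟨D.1, (hI D).2⟩ : Diagonal d n)) ∘ₗ
      (interpolationMatrix w).mulVecLin
  suffices h : Function.Injective f by
    intro x y hxy
    apply h
    simp only [f, LinearMap.comp_apply, Matrix.mulVecLin_apply, hxy]
  have hcard : Fintype.card I = Fintype.card (Exponent d (n - d)) := by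
    rw [card_exponent hd hn, Fintype.card_coe]
    simp
  refine (LinearMap.injective_iff_surjective_of_finrank_eq_finrank
    (by
    rw [Module.finrank_fintype_fun_eq_card, Module.finrank_fintype_fun_eq_card]
    convert hcard.symm)).2 ?_
  rw [← LinearMap.range_eq_top, eq_top_iff, ← (Pi.basisFun ℝ I).span_eq, Submodule.span_le]
  rintro _ ⟨D, rfl⟩
  let q : MvPolynomial (Fin d) ℝ := ∏ i ∈ (insert j₀ D.1)ᶜ, linearForm (w i)
  let D' : Diagonal d n := ⟨D.1, (hI D).2⟩
  have hq : q.IsHomogeneous (n - d) := by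
    have := prod_linearForm_isHomogeneous w (insert j₀ D.1)ᶜ
    rwa [Finset.card_compl, D'.card_insert hd (hI D).1, Fintype.card_fin] at this
  have hf : ∀ E : I, f (fun e => q.coeff e.1) E =
      ∏ i ∈ (insert j₀ D.1)ᶜ, (Diagonal.dual w ⟨E.1, (hI E).2⟩) ⬝ᵥ w i := fun E => by
    refine (interpolationMatrix_mulVec_coeff w hq _).trans ?_
    simp [q, map_prod, eval_linearForm]
  set a : ℝ := ∏ i ∈ (insert j₀ D.1)ᶜ, D'.dual w ⬝ᵥ w i with ha
  have ha0 : a ≠ 0 := Finset.prod_ne_zero_iff.2 fun i hi =>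
    D'.dual_dotProduct_ne_zero hgen hd fun h => by
      simp only [Finset.mem_compl, Finset.mem_insert, not_or] at hi
      exact hi.2 h
  refine ⟨a⁻¹ • fun e => q.coeff e.1, ?_⟩
  rw [map_smul]
  funext E
  rw [Pi.smul_apply, hf, Pi.basisFun_apply]
  by_cases hE : E = D
  · subst hE
    rw [Pi.single_eq_same]
    exact inv_mul_cancel₀ ha0
  · rw [Pi.single_eq_of_ne hE]
    have : ∃ i ∈ E.1, i ∉ D.1 := by
      by_contra! h
      exact hE (Subtype.ext (Finset.eq_of_subset_of_card_le h
        (by rw [(hI E).2, (hI D).2])))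
    obtain ⟨i, hiE, hiD⟩ := this
    rw [Finset.prod_eq_zero (i := i), smul_zero]
    · simp only [Finset.mem_compl, Finset.mem_insert, not_or]
      exact ⟨fun h => (hI E).1 (h ▸ hiE), hiD⟩
    · exact Diagonal.dual_dotProduct_mem w hd _ hiE

theorem rank_interpolationMatrix (hgen : GeneralPosition w) (hd : 1 ≤ d) (hn : d ≤ n) :
    (interpolationMatrix w).rank = (n - 1).choose (d - 1) := by
  rw [Matrix.rank, LinearMap.finrank_range_of_inj (interpolationMatrix_injective hgen hd hn)]
  simp only [Module.finrank_fintype_fun_eq_card]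
  exact card_exponent hd hn

theorem eq_of_eval_dual_eq (hgen : GeneralPosition w) (hd : 1 ≤ d) (hn : d ≤ n)
    {p q : MvPolynomial (Fin d) ℝ} (hp : p.IsHomogeneous (n - d)) (hq : q.IsHomogeneous (n - d))
    (h : ∀ D : Diagonal d n, eval (D.dual w) p = eval (D.dual w) q) : p = q := by
  have := interpolationMatrix_injective hgen hd hn (a₁ := fun e => p.coeff e.1)
    (a₂ := fun e => q.coeff e.1) (by
      funext D
      rw [interpolationMatrix_mulVec_coeff w hp, interpolationMatrix_mulVec_coeff w hq, h])
  ext e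
  by_cases he : ∑ i, e i = n - d
  · exact congrFun this ⟨e, mem_exponent_iff.2 he⟩
  · have hdeg : e.degree ≠ n - d := by rwa [Finsupp.degree_eq_sum]
    rw [hp.coeff_eq_zero hdeg, hq.coeff_eq_zero hdeg]

end Interpolation

/-! ### Pointed cones and positive functionals -/

section Pointed

variable {v : Fin d → ℝ} {w : Fin n → Fin d → ℝ}

theorem mem_convexHull_range_iff {u : Fin n → Fin d → ℝ} {x : Fin d → ℝ} :
    x ∈ convexHull ℝ (Set.range u) ↔
      ∃ a : Fin n → ℝ, (∀ i, 0 ≤ a i) ∧ ∑ i, a i = 1 ∧ ∑ i, a i • u i = x := by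
  have h : Set.range u = (Fintype.linearCombination ℝ u) ''
      (Set.range fun i : Fin n => Pi.single i 1) := by
    rw [← Set.range_comp]
    congr 1
    funext i
    simp [Fintype.linearCombination_apply_single]
  rw [h, ← LinearMap.image_convexHull, convexHull_rangle_single_eq_stdSimplex]
  constructor
  · rintro ⟨a, ha, rfl⟩
    exact ⟨a, ha.1, ha.2, by simp [Fintype.linearCombination_apply]⟩
  · rintro ⟨a, h1, h2, h3⟩
    exact ⟨a, ⟨h1, h2⟩, by simpa [Fintype.linearCombination_apply] using h3⟩

theorem exists_dotProduct_eq_dual (f : Module.Dual ℝ (Fin d → ℝ)) :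
    ∃ l : Fin d → ℝ, ∀ x, f x = l ⬝ᵥ x := by
  refine ⟨fun k => f (Pi.single k 1), fun x => ?_⟩
  have := LinearMap.pi_apply_eq_sum_univ f x
  simp only [smul_eq_mul] at this
  rw [this, dotProduct]
  refine Finset.sum_congr rfl fun k _ => ?_
  rw [mul_comm]
  congr 2
  ext j
  simp [Pi.single_apply, eq_comm]

/-- If `t k > 0`, the relation puts `-w k` in the cone of the generators, so the line through `v` in
direction `w k` lies in `K`. -/
theorem ContainsNoLine.eq_zero_of_sum (hline : ContainsNoLine (cone v w))
    (hw : ∀ i, w i ≠ 0) {t : Fin n → ℝ} (ht : ∀ i, 0 ≤ t i) (h : ∑ i, t i • w i = 0) : t = 0 := by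
  by_contra hne
  obtain ⟨k, hk⟩ := Function.ne_iff.1 hne
  have hk : 0 < t k := lt_of_le_of_ne (ht k) (Ne.symm hk)
  refine hline ⟨v, w k, hw k, fun s => ?_⟩
  -- Adding a multiple of the relation leaves the sum unchanged; this multiple makes the coefficient
  -- at `k` equal to `|s| + s ≥ 0`.
  refine ⟨fun i => |s| / t k * t i + (Pi.single k s : Fin n → ℝ) i, fun i => ?_, ?_⟩
  · by_cases hi : i = k
    · subst hi
      beta_reduce
      rw [Pi.single_eq_same, div_mul_cancel₀ _ hk.ne']
      linarith [neg_abs_le s]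
    · beta_reduce
      rw [Pi.single_eq_of_ne hi, add_zero]
      exact mul_nonneg (div_nonneg (abs_nonneg s) hk.le) (ht i)
  · simp only [add_smul, Finset.sum_add_distrib, mul_smul, ← Finset.smul_sum, h, smul_zero,
      zero_add]
    rw [Finset.sum_eq_single k] <;> simp +contextual

/-- The dual cone of a pointed cone has nonempty interior. -/
theorem ContainsNoLine.exists_dotProduct_pos (hline : ContainsNoLine (cone v w))
    (hw : ∀ i, w i ≠ 0) : ∃ l : Fin d → ℝ, ∀ i, 0 < l ⬝ᵥ w i := by
  have h0 : (0 : Fin d → ℝ) ∉ convexHull ℝ (Set.range w) := by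
    rw [mem_convexHull_range_iff]
    rintro ⟨a, ha, ha1, ha0⟩
    rw [hline.eq_zero_of_sum hw ha ha0] at ha1
    simp at ha1
  -- Strict separation of 0 from the closed hull bounds `f` below on the hull by `u > 0`.
  obtain ⟨f, u, hf0, hf⟩ := geometric_hahn_banach_point_closed (convex_convexHull ℝ _)
    ((Set.finite_range w).isClosed_convexHull ℝ) h0
  obtain ⟨l, hl⟩ := exists_dotProduct_eq_dual (f : (Fin d → ℝ) →ₗ[ℝ] ℝ)
  simp only [ContinuousLinearMap.coe_coe] at hl
  refine ⟨l, fun i => ?_⟩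
  rw [map_zero] at hf0
  rw [← hl]
  exact hf0.trans (hf _ (subset_convexHull ℝ _ ⟨i, rfl⟩))

end Pointed

/-! ### The hyperplane section is a simplicial polytope -/

section Polytope

variable {w : Fin n → Fin d → ℝ} (v l : Fin d → ℝ)

/-- The point in which the ray from `v` in direction `w i` meets the hyperplane
`⟨l, x - v⟩ = 1`. -/
def rayPoint (w : Fin n → Fin d → ℝ) (i : Fin n) : Fin d → ℝ := v + (l ⬝ᵥ w i)⁻¹ • w i

variable {l}

theorem dotProduct_rayPoint (hl : ∀ i, 0 < l ⬝ᵥ w i) (i : Fin n) :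
    l ⬝ᵥ rayPoint v l w i = l ⬝ᵥ v + 1 := by
  rw [rayPoint, dotProduct_add, dotProduct_smul, smul_eq_mul, inv_mul_cancel₀ (hl i).ne']

theorem affineIndependent_rayPoint (hgen : GeneralPosition w) (hn : d ≤ n)
    (hl : ∀ i, 0 < l ⬝ᵥ w i) {S : Finset (Fin n)} (hS : S.card ≤ d) :
    AffineIndependent ℝ fun i : S => rayPoint v l w i := by
  obtain ⟨T, hST, hT⟩ := Finset.exists_superset_card_eq hS (by simpa using hn)
  have h1 : LinearIndependent ℝ fun i : S => w i :=
    (hgen T hT).comp (fun i : S => ⟨i, hST i.2⟩) fun a b h => Subtype.ext (Subtype.mk.inj h)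
  have h2 := h1.units_smul fun i => (Units.mk0 _ (hl i).ne')⁻¹
  have h3 := h2.affineIndependent.vadd (v := v)
  exact h3

theorem dotProduct_eq_zero_of_mem_vectorSpan_rayPoint (hl : ∀ i, 0 < l ⬝ᵥ w i) {x : Fin d → ℝ}
    (hx : x ∈ vectorSpan ℝ (Set.range (rayPoint v l w))) : l ⬝ᵥ x = 0 := by
  have : vectorSpan ℝ (Set.range (rayPoint v l w)) ≤
      LinearMap.ker (dotProductBilin ℝ ℝ l : (Fin d → ℝ) →ₗ[ℝ] ℝ) := by
    rw [vectorSpan_def, Submodule.span_le]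
    rintro _ ⟨_, ⟨i, rfl⟩, _, ⟨j, rfl⟩, rfl⟩
    change l ⬝ᵥ (rayPoint v l w i - rayPoint v l w j) = 0
    rw [dotProduct_sub, dotProduct_rayPoint v hl, dotProduct_rayPoint v hl, sub_self]
  exact this hx

/-- The span lies in the kernel of `l ≠ 0`, and `d` of the points are affinely independent. -/
theorem finrank_vectorSpan_rayPoint (hgen : GeneralPosition w) (hd : 1 ≤ d) (hn : d ≤ n)
    (hl : ∀ i, 0 < l ⬝ᵥ w i) :
    Module.finrank ℝ (vectorSpan ℝ (Set.range (rayPoint v l w))) = d - 1 := by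
  apply le_antisymm
  · have hlt : vectorSpan ℝ (Set.range (rayPoint v l w)) < ⊤ := by
      refine lt_top_iff_ne_top.2 fun h => (hl ⟨0, by omega⟩).ne' ?_
      apply dotProduct_eq_zero_of_mem_vectorSpan_rayPoint v hl
      rw [h]
      trivial
    have := Submodule.finrank_lt hlt.ne
    simp only [Module.finrank_fintype_fun_eq_card, Fintype.card_fin] at this
    omega
  · obtain ⟨T, -, hT⟩ := Finset.exists_superset_card_eq (s := (∅ : Finset (Fin n)))
      (Nat.zero_le d) (by simpa using hn)
    have h := (affineIndependent_rayPoint v hgen hn hl hT.le).finrank_vectorSpan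
      (n := d - 1) (by simp [hT]; omega)
    rw [← h]
    apply Submodule.finrank_mono
    apply vectorSpan_mono
    rintro _ ⟨i, rfl⟩
    exact ⟨i, rfl⟩

theorem notMem_affineSpan_rayPoint (hd : 1 ≤ d) (hn : d ≤ n) (hl : ∀ i, 0 < l ⬝ᵥ w i) :
    v ∉ affineSpan ℝ (Set.range (rayPoint v l w)) := by
  intro h
  have h1 := AffineSubspace.vsub_mem_direction h
    (subset_affineSpan ℝ (Set.range (rayPoint v l w)) ⟨⟨0, by omega⟩, rfl⟩)
  rw [direction_affineSpan] at h1
  have := dotProduct_eq_zero_of_mem_vectorSpan_rayPoint v hl h1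
  rw [vsub_eq_sub, dotProduct_sub, dotProduct_rayPoint v hl] at this
  linarith

/-- A hyperplane that contains `d` of the points `rayPoint v l w i` contains all of them. -/
theorem dotProduct_rayPoint_eq (hgen : GeneralPosition w) (hl : ∀ i, 0 < l ⬝ᵥ w i)
    {T : Finset (Fin n)} (hT : T.card = d) {g : Fin d → ℝ} {M : ℝ}
    (hg : ∀ i ∈ T, g ⬝ᵥ rayPoint v l w i = M) (i : Fin n) : g ⬝ᵥ rayPoint v l w i = M := by
  -- As `l` is 1 on the rescaled generators, the affine equation at the point becomes a linear one
  -- at `w i`.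
  have key : ∀ i, g ⬝ᵥ rayPoint v l w i = M ↔ (g - (M - g ⬝ᵥ v) • l) ⬝ᵥ w i = 0 := by
    intro i
    have := (hl i).ne'
    rw [rayPoint, dotProduct_add, dotProduct_smul, sub_dotProduct, smul_dotProduct, smul_eq_mul,
      smul_eq_mul]
    field_simp
    constructor <;> intro h <;> linarith
  have h0 := hgen.eq_zero_of_dotProduct hT fun i hi => (key i).1 (hg i hi)
  rw [key, h0, zero_dotProduct]

/-- A face is the hull of the points at which its supporting functional attains its maximum `M`.
More than `d` such points would force all points into the face; at most `d` points are affinely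
independent. -/
theorem exposed_face_rayPoint (hgen : GeneralPosition w) (hn : d ≤ n)
    (hl : ∀ i, 0 < l ⬝ᵥ w i) {F : Set (Fin d → ℝ)}
    (hF : IsExposed ℝ (convexHull ℝ (Set.range (rayPoint v l w))) F)
    (hFP : F ≠ convexHull ℝ (Set.range (rayPoint v l w))) :
    ∃ T : Finset (Fin d → ℝ), AffineIndependent ℝ (fun x : T => (x : Fin d → ℝ)) ∧
      F = convexHull ℝ (T : Set (Fin d → ℝ)) := by
  classical
  set u := rayPoint v l w with hu
  rcases F.eq_empty_or_nonempty with rfl | hne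
  -- `IsExposed` admits the empty face, which is the hull of no points.
  · exact ⟨∅, affineIndependent_of_subsingleton ℝ _, by simp⟩
  have hconv := hF.convex (convex_convexHull ℝ _)
  obtain ⟨f, hfF⟩ := hF hne
  obtain ⟨x₀, hx₀⟩ := hne
  obtain ⟨g, hg⟩ := exists_dotProduct_eq_dual (f : (Fin d → ℝ) →ₗ[ℝ] ℝ)
  simp only [ContinuousLinearMap.coe_coe] at hg
  set M := f x₀ with hM
  have hx₀' := hx₀
  rw [hfF] at hx₀'
  have hle : ∀ i, f (u i) ≤ M := fun i => hx₀'.2 _ (subset_convexHull ℝ _ ⟨i, rfl⟩)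
  have hmem : ∀ x ∈ convexHull ℝ (Set.range u), x ∈ F ↔ f x = M := by
    intro x hx
    constructor
    · intro h
      rw [hfF] at h
      exact le_antisymm (hx₀'.2 x hx) (h.2 _ hx₀'.1)
    · intro h
      rw [hfF]
      exact ⟨hx, fun y hy => h ▸ hx₀'.2 y hy⟩
  set S : Finset (Fin n) := Finset.univ.filter fun i => f (u i) = M with hS
  have hFS : F = convexHull ℝ (u '' S) := by
    apply Set.Subset.antisymm
    · intro x hx
      have hxP := hF.subset hx
      have hfx := (hmem x hxP).1 hx
      obtain ⟨a, ha0, ha1, hax⟩ := mem_convexHull_range_iff.1 hxP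
      -- All terms are nonnegative, so the weights vanish off `S`.
      have hsum : ∑ i, a i * (M - f (u i)) = 0 := by
        simp only [mul_sub, Finset.sum_sub_distrib, ← Finset.sum_mul, ha1]
        rw [← hfx, ← hax, map_sum]
        simp
      have hz := (Finset.sum_eq_zero_iff_of_nonneg fun i _ =>
        mul_nonneg (ha0 i) (sub_nonneg.2 (hle i))).1 hsum
      have haS : ∀ i ∉ S, a i = 0 := by
        intro i hi
        rcases mul_eq_zero.1 (hz i (Finset.mem_univ i)) with h | h
        · exact h
        · exact absurd (by simp [hS]; linarith) hi
      have h1 : ∑ i ∈ S, a i = 1 := by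
        rw [← ha1]
        exact Finset.sum_subset (Finset.subset_univ _) fun i _ hi => haS i hi
      have h2 : ∑ i ∈ S, a i • u i = x := by
        rw [← hax]
        exact Finset.sum_subset (Finset.subset_univ _) fun i _ hi => by simp [haS i hi]
      rw [← h2]
      exact (convex_convexHull ℝ _).sum_mem (fun i _ => ha0 i) h1
        fun i hi => subset_convexHull ℝ _ ⟨i, hi, rfl⟩
    · refine convexHull_min ?_ hconv
      rintro _ ⟨i, hi, rfl⟩
      refine (hmem _ (subset_convexHull ℝ _ ⟨i, rfl⟩)).2 ?_
      simpa [hS] using hi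
  have hcard : S.card ≤ d := by
    by_contra! hlt
    obtain ⟨T, hTS, hT⟩ := Finset.exists_subset_card_eq hlt.le
    have hall := dotProduct_rayPoint_eq v hgen hl hT (g := g) (M := M) fun i hi => by
      rw [← hg]
      simpa [hS] using hTS hi
    apply hFP
    rw [hFS, ← Set.image_univ]
    congr 2
    ext i
    simp [hS, hg, hall i, hu]
  refine ⟨S.image u, ?_, by rw [hFS, Finset.coe_image]⟩
  have := (affineIndependent_rayPoint v hgen hn hl hcard).range
  have hr : ((S.image u : Finset (Fin d → ℝ)) : Set (Fin d → ℝ)) =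
      Set.range fun i : S => rayPoint v l w i := by
    ext x
    simp [hu]
  rw [← hr] at this
  exact this

theorem cone_eq_rayPoint (hd : 1 ≤ d) (hn : d ≤ n) (hl : ∀ i, 0 < l ⬝ᵥ w i) :
    cone v w = {x | ∃ t : ℝ, 0 ≤ t ∧ ∃ y ∈ convexHull ℝ (Set.range (rayPoint v l w)),
      x = v + t • (y - v)} := by
  ext x
  have hsub : ∀ a : Fin n → ℝ, ∑ i, a i = 1 → ∑ i, a i • rayPoint v l w i - v =
      ∑ i, (a i * (l ⬝ᵥ w i)⁻¹) • w i := fun a ha => by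
    simp only [rayPoint, smul_add, Finset.sum_add_distrib, ← Finset.sum_smul, ha, smul_smul]
    simp
  constructor
  · rintro ⟨t, ht, rfl⟩
    -- This is the height `⟨l, x - v⟩`. At height 0 the point is `v`; otherwise dividing by the
    -- height gives convex weights.
    have hτ0 : 0 ≤ ∑ i, t i * (l ⬝ᵥ w i) :=
      Finset.sum_nonneg fun i _ => mul_nonneg (ht i) (hl i).le
    rcases hτ0.eq_or_lt with hτ | hτ
    · refine ⟨0, le_rfl, rayPoint v l w ⟨0, by omega⟩, subset_convexHull ℝ _ ⟨_, rfl⟩, ?_⟩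
      have hz := (Finset.sum_eq_zero_iff_of_nonneg fun i _ =>
        mul_nonneg (ht i) (hl i).le).1 hτ.symm
      have : ∀ i, t i = 0 := fun i =>
        (mul_eq_zero.1 (hz i (Finset.mem_univ i))).resolve_right (hl i).ne'
      simp [this]
    · set τ := ∑ i, t i * (l ⬝ᵥ w i) with hτdef
      have ha1 : ∑ i, t i * (l ⬝ᵥ w i) / τ = 1 := by
        rw [← Finset.sum_div, ← hτdef, div_self hτ.ne']
      refine ⟨τ, hτ0, _, mem_convexHull_range_iff.2
        ⟨fun i => t i * (l ⬝ᵥ w i) / τ, fun i => ?_, ha1, rfl⟩, ?_⟩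
      · have := ht i
        have := hl i
        positivity
      · rw [hsub _ ha1, Finset.smul_sum]
        congr 1
        refine Finset.sum_congr rfl fun i _ => ?_
        rw [smul_smul]
        congr 1
        have := (hl i).ne'
        have := hτ.ne'
        field_simp
  · rintro ⟨t, ht, y, hy, rfl⟩
    obtain ⟨a, ha0, ha1, rfl⟩ := mem_convexHull_range_iff.1 hy
    refine ⟨fun i => t * (a i * (l ⬝ᵥ w i)⁻¹), fun i => ?_, ?_⟩
    · have := ha0 i
      have := hl i
      positivity
    · rw [hsub a ha1, Finset.smul_sum]
      simp only [smul_smul]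

theorem isConeOverSimplicialPolytope_cone (hgen : GeneralPosition w) (hd : 1 ≤ d) (hn : d ≤ n)
    (hl : ∀ i, 0 < l ⬝ᵥ w i) : IsConeOverSimplicialPolytope v (cone v w) := by
  classical
  refine ⟨convexHull ℝ (Set.range (rayPoint v l w)), ⟨?_, ⟨Finset.univ.image (rayPoint v l w), ?_⟩,
    ?_, fun F hF hFP => exposed_face_rayPoint v hgen hn hl hF hFP⟩, ?_, cone_eq_rayPoint v hd hn hl⟩
  · exact ⟨_, subset_convexHull ℝ _ ⟨⟨0, by omega⟩, rfl⟩⟩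
  · simp
  · rw [← direction_affineSpan, affineSpan_convexHull, direction_affineSpan]
    exact finrank_vectorSpan_rayPoint v hgen hd hn hl
  · rw [affineSpan_convexHull]
    exact notMem_affineSpan_rayPoint v hd hn hl

end Polytope

/-! ### Extremal diagonals and supporting hyperplanes -/

section Extremal

variable {v : Fin d → ℝ} {w : Fin n → Fin d → ℝ}

theorem cone_comp_subset {m : ℕ} (f : Fin m → Fin n) :
    cone v (fun k => w (f k)) ⊆ cone v w := by
  rintro _ ⟨t, ht, rfl⟩
  refine ⟨fun i => ∑ k, if f k = i then t k else 0,
    fun i => Finset.sum_nonneg fun k _ => by split_ifs <;> simp [ht], ?_⟩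
  simp only [Finset.sum_smul]
  rw [Finset.sum_comm]
  simp

theorem Diagonal.dual_dotProduct_vectors (hd : 1 ≤ d) (D : Diagonal d n) (k : Fin (d - 1)) :
    D.dual w ⬝ᵥ D.vectors w k = 0 :=
  D.dual_dotProduct_mem w hd (D.1.orderEmbOfFin_mem D.2 k)

/-- On `K` the functional `l` is at least `⟨l, v⟩`, with equality on the smaller cone; a small step
from there along `-l` leaves `K`. -/
theorem subset_frontier_of_dotProduct_nonneg {l : Fin d → ℝ} (hl0 : l ≠ 0)
    (hl : ∀ j, 0 ≤ l ⬝ᵥ w j) {m : ℕ} (f : Fin m → Fin n) (hf : ∀ k, l ⬝ᵥ w (f k) = 0) :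
    cone v (fun k => w (f k)) ⊆ frontier (cone v w) := by
  intro x hx
  refine ⟨subset_closure (cone_comp_subset f hx), fun hint => ?_⟩
  have hlx : l ⬝ᵥ x = l ⬝ᵥ v := by
    obtain ⟨t, -, rfl⟩ := hx
    rw [dotProduct_add, dotProduct_sum_smul]
    simp [hf]
  have hcont : Filter.Tendsto (fun ε : ℝ => x - ε • l) (nhdsWithin 0 (Set.Ioi 0)) (nhds x) := by
    have : Continuous fun ε : ℝ => x - ε • l := by fun_prop
    simpa using (this.tendsto 0).mono_left nhdsWithin_le_nhds
  obtain ⟨ε, hε, hε0⟩ := ((hcont.eventually (mem_interior_iff_mem_nhds.1 hint)).and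
    self_mem_nhdsWithin).exists
  obtain ⟨t, ht, h⟩ := hε
  have h1 : l ⬝ᵥ (x - ε • l) = l ⬝ᵥ v + ∑ i, t i * (l ⬝ᵥ w i) := by
    rw [h, dotProduct_add, dotProduct_sum_smul]
  rw [dotProduct_sub, dotProduct_smul, hlx, smul_eq_mul] at h1
  have h2 : 0 ≤ ∑ i, t i * (l ⬝ᵥ w i) := Finset.sum_nonneg fun i _ => mul_nonneg (ht i) (hl i)
  have h3 : 0 < l ⬝ᵥ l := by
    have : 0 ≤ l ⬝ᵥ l := Finset.sum_nonneg fun i _ => mul_self_nonneg (l i)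
    exact lt_of_le_of_ne this fun h => hl0 (dotProduct_self_eq_zero.1 h.symm)
  have := mul_pos hε0 h3
  linarith

/-- If no nonzero functional that is nonpositive on the generators is nonnegative at `y`, then
`v + y` lies in the interior of the cone. -/
theorem mem_interior_cone (hgen : GeneralPosition w) (hn : d ≤ n) {y : Fin d → ℝ}
    (hy : ∀ l : Fin d → ℝ, (∀ i, l ⬝ᵥ w i ≤ 0) → 0 ≤ l ⬝ᵥ y → l = 0) :
    v + y ∈ interior (cone v w) := by
  let Φ : (Fin n → ℝ) →ₗ[ℝ] (Fin d → ℝ) := Fintype.linearCombination ℝ w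
  have hΦ : ∀ t, Φ t = ∑ i, t i • w i := fun t => rfl
  have hsurj : Function.Surjective Φ := by
    obtain ⟨T, -, hT⟩ := Finset.exists_superset_card_eq (s := (∅ : Finset (Fin n)))
      (Nat.zero_le d) (by simpa using hn)
    intro x
    obtain ⟨c, -, hc⟩ := hgen.exists_sum_eq hT x
    exact ⟨c, hc⟩
  -- The image of the open orthant is open and convex; if it misses `y`, a separating functional
  -- contradicts `hy`.
  let O : Set (Fin n → ℝ) := Set.univ.pi fun _ => Set.Ioi 0
  have hO : IsOpen (Φ '' O) :=
    Φ.isOpenMap_of_finiteDimensional hsurj _ (isOpen_set_pi Set.finite_univ fun _ _ => isOpen_Ioi)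
  have hconv : Convex ℝ (Φ '' O) := (convex_pi fun _ _ => convex_Ioi 0).linear_image Φ
  have hyO : y ∈ Φ '' O := by
    by_contra hyO
    obtain ⟨f, hf⟩ := geometric_hahn_banach_open_point hconv hO hyO
    obtain ⟨l, hl⟩ := exists_dotProduct_eq_dual (f : (Fin d → ℝ) →ₗ[ℝ] ℝ)
    simp only [ContinuousLinearMap.coe_coe] at hl
    have hlt : ∀ t : Fin n → ℝ, (∀ i, 0 < t i) → ∑ i, t i * (l ⬝ᵥ w i) < l ⬝ᵥ y := by
      intro t ht
      have := hf _ ⟨t, fun i _ => ht i, rfl⟩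
      rwa [hl, hl, hΦ, dotProduct_sum_smul] at this
    set Y := l ⬝ᵥ y
    set S := ∑ i, l ⬝ᵥ w i
    have h1 : ∀ i, l ⬝ᵥ w i ≤ 0 := by
      intro i
      by_contra! hi
      have hM : 0 ≤ |Y - S| / (l ⬝ᵥ w i) := by positivity
      -- These coefficients give the value `S + |Y - S| ≥ Y`, against the strict bound.
      have := hlt (fun j => 1 + (Pi.single i (|Y - S| / (l ⬝ᵥ w i)) : Fin n → ℝ) j) fun j => by
        by_cases hj : j = i
        · subst hj
          rw [Pi.single_eq_same]
          linarith
        · simp [Pi.single_eq_of_ne hj]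
      have hsingle : ∑ j, (Pi.single i (|Y - S| / (l ⬝ᵥ w i)) : Fin n → ℝ) j * (l ⬝ᵥ w j) =
          |Y - S| / (l ⬝ᵥ w i) * (l ⬝ᵥ w i) := by
        simp [Pi.single_apply]
      simp only [add_mul, one_mul, Finset.sum_add_distrib] at this
      rw [hsingle, div_mul_cancel₀ _ hi.ne'] at this
      linarith [le_abs_self (Y - S)]
    have h2 : 0 ≤ Y := by
      by_contra! hY
      have hS0 : S ≤ 0 := Finset.sum_nonpos fun i _ => h1 i
      have hε : ∀ ε : ℝ, 0 < ε → ε * S < Y := fun ε hε => by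
        have := hlt (fun _ => ε) fun _ => hε
        rwa [← Finset.mul_sum] at this
      rcases hS0.eq_or_lt with h | h
      · have := hε 1 one_pos
        linarith
      · have := hε (Y / S) (div_pos_of_neg_of_neg hY h)
        rw [div_mul_cancel₀ _ h.ne] at this
        exact lt_irrefl _ this
    have hl0 := hy l h1 h2
    have := hlt (fun _ => 1) fun _ => one_pos
    simp [hl0, Y] at this
  rw [mem_interior_iff_mem_nhds]
  have hopen : IsOpen ((fun x => v + x) '' (Φ '' O)) := (Homeomorph.addLeft v).isOpenMap _ hO
  refine Filter.mem_of_superset (hopen.mem_nhds ⟨y, hyO, rfl⟩) ?_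
  rintro _ ⟨_, ⟨t, ht, rfl⟩, rfl⟩
  exact ⟨t, fun i => (ht i trivial).le, rfl⟩

/-- A diagonal is extremal iff all generators lie on the same side of the hyperplane it spans. -/
theorem Diagonal.isExtremal_iff (hgen : GeneralPosition w) (hd : 1 ≤ d) (hn : d ≤ n)
    (D : Diagonal d n) : D.IsExtremal v w ↔
      (∀ j, 0 ≤ D.dual w ⬝ᵥ w j) ∨ ∀ j, D.dual w ⬝ᵥ w j ≤ 0 := by
  have hne : D.dual w ≠ 0 := by
    obtain ⟨j, hj⟩ := D.exists_notMem hd hn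
    intro h
    have := D.dual_dotProduct_ne_zero hgen hd hj
    simp [h] at this
  constructor
  · intro hext
    by_contra! hcon
    obtain ⟨⟨j, hj⟩, k, hk⟩ := hcon
    -- A functional that is nonpositive on all generators and nonnegative at the sum of those in `D`
    -- vanishes on `D`, so it is a multiple of `D*`. Generators on both sides of the hyperplane
    -- force the multiple to be 0.
    have hx : v + ∑ k, D.vectors w k ∈ cone v (D.vectors w) :=
      ⟨fun _ => 1, fun _ => zero_le_one, by simp⟩
    refine (hext hx).2 (mem_interior_cone hgen hn fun l hl hly => ?_)
    rw [dotProduct_sum] at hly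
    have hz : ∀ i ∈ D.1, l ⬝ᵥ w i = 0 := by
      intro i hi
      have : i ∈ Set.range (D.1.orderEmbOfFin D.2) := by simpa using hi
      obtain ⟨m, rfl⟩ := this
      exact (Finset.sum_eq_zero_iff_of_nonpos (fun m _ => hl _)).1
        (le_antisymm (Finset.sum_nonpos fun m _ => hl _) hly) m (Finset.mem_univ m)
    obtain ⟨c, rfl⟩ := D.eq_smul_dual hgen hd hn hz
    have h1 := hl j
    have h2 := hl k
    rw [smul_dotProduct, smul_eq_mul] at h1 h2
    have : c = 0 := le_antisymm (by nlinarith) (by nlinarith)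
    rw [this, zero_smul]
  · rintro (h | h)
    · exact subset_frontier_of_dotProduct_nonneg hne h _ (D.dual_dotProduct_vectors hd)
    · exact subset_frontier_of_dotProduct_nonneg (neg_ne_zero.2 hne)
        (fun j => by rw [neg_dotProduct]; linarith [h j]) _
        fun k => by
          rw [neg_dotProduct, neg_eq_zero]
          exact D.dual_dotProduct_vectors hd k

end Extremal

section Interval

/-! The ends of the interval of all `s` with `s * a j ≤ c j` for all `j ∈ J`. -/

variable {ι : Type*} {J : Finset ι} {a c : ι → ℝ}

/-- The constraint `s * a k ≤ c k` is tight at a point at which all others are slack. -/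
def IsEnd (J : Finset ι) (a c : ι → ℝ) (k : ι) : Prop :=
  k ∈ J ∧ ∀ j ∈ J, j ≠ k → c k / a k * a j < c j

theorem IsEnd.neg_iff {k : ι} : IsEnd J (fun j => -a j) c k ↔ IsEnd J a c k := by
  unfold IsEnd
  simp [div_neg]

theorem IsEnd.le {k : ι} (hk : IsEnd J a c k) (ha : ∀ j ∈ J, a j ≠ 0) {j : ι} (hj : j ∈ J) :
    c k / a k * a j ≤ c j := by
  by_cases h : j = k
  · subst h
    rw [div_mul_cancel₀ _ (ha j hj)]
  · exact (hk.2 j hj h).le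

theorem IsEnd.eq_of_pos {k k' : ι} (hk : IsEnd J a c k) (hk' : IsEnd J a c k')
    (h : 0 < a k) (h' : 0 < a k') : k = k' := by
  by_contra hne
  have h1 := hk.2 k' hk'.1 (Ne.symm hne)
  have h2 := hk'.2 k hk.1 hne
  rw [← lt_div_iff₀ h'] at h1
  rw [← lt_div_iff₀ h] at h2
  exact lt_asymm h1 h2

theorem IsEnd.eq_of_neg {k k' : ι} (hk : IsEnd J a c k) (hk' : IsEnd J a c k')
    (h : a k < 0) (h' : a k' < 0) : k = k' :=
  (IsEnd.neg_iff.2 hk).eq_of_pos (IsEnd.neg_iff.2 hk') (neg_pos.2 h) (neg_pos.2 h')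

/-- The upper end is the least ratio `c j / a j` with `a j > 0`. It lies above the feasible `s`, so
constraints with `a j ≤ 0` persist; genericity makes all others strict. -/
theorem exists_isEnd_pos (hgen : ∀ s, ∀ j ∈ J, ∀ k ∈ J, s * a j = c j → s * a k = c k → j = k)
    {s : ℝ} (hs : ∀ j ∈ J, s * a j ≤ c j) (hex : ∃ j ∈ J, 0 < a j) :
    ∃ k, 0 < a k ∧ IsEnd J a c k := by
  classical
  obtain ⟨j₀, hj₀, hj₀'⟩ := hex
  obtain ⟨k, hk, hmin⟩ := Finset.exists_min_image (J.filter fun j => 0 < a j)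
    (fun j => c j / a j) ⟨j₀, by simp [hj₀, hj₀']⟩
  simp only [Finset.mem_filter] at hk hmin
  refine ⟨k, hk.2, hk.1, fun j hj hjk => lt_of_le_of_ne ?_ fun h => hjk ?_⟩
  · rcases lt_or_ge 0 (a j) with h | h
    · rw [← le_div_iff₀ h]
      exact hmin j ⟨hj, h⟩
    · have : s ≤ c k / a k := (le_div_iff₀ hk.2).2 (hs k hk.1)
      exact (mul_le_mul_of_nonpos_right this h).trans (hs j hj)
  · exact hgen _ j hj k hk.1 h (div_mul_cancel₀ _ hk.2.ne')

theorem exists_isEnd_neg (hgen : ∀ s, ∀ j ∈ J, ∀ k ∈ J, s * a j = c j → s * a k = c k → j = k)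
    {s : ℝ} (hs : ∀ j ∈ J, s * a j ≤ c j) (hex : ∃ j ∈ J, a j < 0) :
    ∃ k, a k < 0 ∧ IsEnd J a c k := by
  obtain ⟨k, hk, hk'⟩ := exists_isEnd_pos (J := J) (a := fun j => -a j) (c := c) (s := -s)
    (fun s j hj k hk h1 h2 => hgen (-s) j hj k hk (by linarith) (by linarith))
    (fun j hj => by linarith [hs j hj]) (by simpa using hex)
  exact ⟨k, by simpa using hk, IsEnd.neg_iff.1 hk'⟩

variable {E : Finset ι}

theorem sum_sign_of_pos (hE : ∀ k, k ∈ E ↔ IsEnd J a c k)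
    (hgen : ∀ s, ∀ j ∈ J, ∀ k ∈ J, s * a j = c j → s * a k = c k → j = k)
    (hJ : J.Nonempty) (ha : ∀ j ∈ J, 0 < a j) : ∑ k ∈ E, (SignType.sign (a k) : ℝ) = 1 := by
  -- With all slopes positive, any sufficiently negative point is feasible.
  have hs : ∀ j ∈ J, -(∑ j ∈ J, |c j / a j|) * a j ≤ c j := by
    intro j hj
    rw [← le_div_iff₀ (ha j hj)]
    have := Finset.single_le_sum (f := fun j => |c j / a j|) (fun _ _ => abs_nonneg _) hj
    linarith [neg_abs_le (c j / a j)]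
  obtain ⟨j, hj⟩ := hJ
  obtain ⟨k, hk, hk'⟩ := exists_isEnd_pos hgen hs ⟨j, hj, ha j hj⟩
  have : E = {k} := Finset.eq_singleton_iff_unique_mem.2 ⟨(hE k).2 hk', fun i hi =>
    ((hE i).1 hi).eq_of_pos hk' (ha i ((hE i).1 hi).1) hk⟩
  rw [this, Finset.sum_singleton, sign_pos hk]
  rfl

theorem sum_sign_of_neg (hE : ∀ k, k ∈ E ↔ IsEnd J a c k)
    (hgen : ∀ s, ∀ j ∈ J, ∀ k ∈ J, s * a j = c j → s * a k = c k → j = k)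
    (hJ : J.Nonempty) (ha : ∀ j ∈ J, a j < 0) : ∑ k ∈ E, (SignType.sign (a k) : ℝ) = -1 := by
  have := sum_sign_of_pos (E := E) (a := fun j => -a j) (c := c)
    (fun k => (hE k).trans IsEnd.neg_iff.symm)
    (fun s j hj k hk h1 h2 => hgen (-s) j hj k hk (by linarith) (by linarith)) hJ
    (fun j hj => neg_pos.2 (ha j hj))
  simp only [Left.sign_neg, SignType.coe_neg, Finset.sum_neg_distrib] at this
  linarith

/-- Any end is itself a feasible point, and then there is exactly one upper and one lower end, with
cancelling signs. -/
theorem sum_sign_of_pos_of_neg (hE : ∀ k, k ∈ E ↔ IsEnd J a c k)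
    (hgen : ∀ s, ∀ j ∈ J, ∀ k ∈ J, s * a j = c j → s * a k = c k → j = k)
    (ha : ∀ j ∈ J, a j ≠ 0) (hpos : ∃ j ∈ J, 0 < a j) (hneg : ∃ j ∈ J, a j < 0) :
    ∑ k ∈ E, (SignType.sign (a k) : ℝ) = 0 := by
  classical
  rcases E.eq_empty_or_nonempty with rfl | ⟨i, hi⟩
  · simp
  have hi' := (hE i).1 hi
  obtain ⟨k, hk, hk'⟩ := exists_isEnd_pos hgen (fun j hj => hi'.le ha hj) hpos
  obtain ⟨m, hm, hm'⟩ := exists_isEnd_neg hgen (fun j hj => hi'.le ha hj) hneg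
  have hkm : k ≠ m := fun h => by
    rw [h] at hk
    exact lt_asymm hk hm
  have : E = {k, m} := by
    ext j
    rw [hE, Finset.mem_insert, Finset.mem_singleton]
    constructor
    · intro hj
      rcases (ha j hj.1).lt_or_gt with h | h
      · exact Or.inr (hj.eq_of_neg hm' h hm)
      · exact Or.inl (hj.eq_of_pos hk' h hk)
    · rintro (rfl | rfl) <;> assumption
  rw [this, Finset.sum_pair hkm, sign_pos hk, sign_neg hm]
  simp

end Interval

/-! ### Regular triangulations by linear programming -/

section Triangulation

variable {w : Fin n → Fin d → ℝ} {h : Fin n → ℝ}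

/-- No linear functional takes the prescribed values `h i` on more than `d` generators `w i`. -/
def IsGenericHeight (w : Fin n → Fin d → ℝ) (h : Fin n → ℝ) : Prop :=
  ∀ (l : Fin d → ℝ) (S : Finset (Fin n)), (∀ i ∈ S, l ⬝ᵥ w i = h i) → S.card ≤ d

/-- The point `x` is in no subspace that is spanned by fewer than `d` generators. -/
def IsGenericPoint (w : Fin n → Fin d → ℝ) (x : Fin d → ℝ) : Prop :=
  ∀ (S : Finset (Fin n)) (c : Fin n → ℝ), S.card < d → (∀ i ∉ S, c i = 0) → ∑ i, c i • w i ≠ x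

/-- The sets of generators that span the maximal cones of the regular triangulation of the cone
given by the heights `h`. -/
def IsRegularCell (w : Fin n → Fin d → ℝ) (h : Fin n → ℝ) (T : Finset (Fin n)) : Prop :=
  T.card = d ∧ ∃ l : Fin d → ℝ, (∀ i ∈ T, l ⬝ᵥ w i = h i) ∧ ∀ j ∉ T, l ⬝ᵥ w j < h j

/-- The simplicial cone spanned by the generators indexed by `T`, moved to the origin. -/
def cellCone (w : Fin n → Fin d → ℝ) (T : Finset (Fin n)) : Set (Fin d → ℝ) :=
  {x | ∃ c : Fin n → ℝ, (∀ i, 0 ≤ c i) ∧ (∀ i ∉ T, c i = 0) ∧ ∑ i, c i • w i = x}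

/-- Each `d`-set `T` and `j ∉ T` exclude one hyperplane of heights, namely those respecting the
expansion of `w j` in the basis `T`. Finitely many hyperplanes do not cover the space. -/
theorem exists_isGenericHeight (hgen : GeneralPosition w) : ∃ h, IsGenericHeight w h := by
  choose c hc hcw using fun (p : {T : Finset (Fin n) // T.card = d} × Fin n) =>
    hgen.exists_sum_eq p.1.2 (w p.2)
  let ι := {p : {T : Finset (Fin n) // T.card = d} × Fin n // p.2 ∉ p.1.1}
  let u : ι → Fin n → ℝ := fun p => Pi.single p.1.2 1 - c p.1
  have hu : ∀ p, u p ≠ 0 := fun p hp => by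
    have := congrFun hp p.1.2
    simp [u, hc p.1 _ p.2] at this
  obtain ⟨f, hf⟩ := Module.exists_dual_forall_apply_ne_zero (K := ℝ) u hu
  obtain ⟨h, hh⟩ := exists_dotProduct_eq_dual f
  refine ⟨h, fun l S hS => ?_⟩
  by_contra! hlt
  obtain ⟨T, hTS, hT⟩ := Finset.exists_subset_card_eq hlt.le
  obtain ⟨j, hjS, hjT⟩ := Finset.exists_mem_notMem_of_card_lt_card (s := T) (t := S) (by omega)
  let p : {T : Finset (Fin n) // T.card = d} × Fin n := (⟨T, hT⟩, j)
  refine hf ⟨p, hjT⟩ ?_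
  have h1 : ∑ i, c p i * h i = l ⬝ᵥ w j := by
    rw [← hcw p, dotProduct_sum_smul]
    refine Finset.sum_congr rfl fun i _ => ?_
    by_cases hi : i ∈ T
    · rw [hS i (hTS hi)]
    · rw [hc p i hi, zero_mul, zero_mul]
  rw [hh]
  simp only [u, dotProduct_sub, dotProduct_single_one]
  rw [dotProduct_comm]
  change h j - ∑ i, c p i * h i = 0
  rw [h1, hS j hjS, sub_self]

/-- Pairing with the positive functional `l` bounds every coefficient; compactness provides a
cheapest representation. -/
theorem isCompact_representations {l : Fin d → ℝ} (hl : ∀ i, 0 < l ⬝ᵥ w i) (x : Fin d → ℝ) :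
    IsCompact {t : Fin n → ℝ | (∀ i, 0 ≤ t i) ∧ ∑ i, t i • w i = x} := by
  refine (isCompact_Icc (a := 0) (b := fun i => l ⬝ᵥ x / (l ⬝ᵥ w i))).of_isClosed_subset ?_ ?_
  · refine IsClosed.and ?_ ?_
    · simp only [Set.ofPred_forall]
      exact isClosed_iInter fun i => isClosed_le continuous_const (continuous_apply i)
    · exact isClosed_eq (by fun_prop) continuous_const
  · rintro t ⟨ht, rfl⟩
    refine ⟨ht, fun i => ?_⟩
    rw [le_div_iff₀ (hl i), dotProduct_sum_smul]
    exact Finset.single_le_sum (f := fun i => t i * (l ⬝ᵥ w i))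
      (fun i _ => mul_nonneg (ht i) (hl i).le) (Finset.mem_univ i)

/-- The cell comes from a representation of `x` of minimal cost `∑ h i * t i`. Its support has at
least `d` elements; take `T` inside it and `l` equal to `h` on `T`. Optimality makes each reduced
cost `h j - ⟨l, w j⟩` nonnegative, genericity makes it nonzero, and then `t j > 0` would allow a
cheaper representation. -/
theorem IsGenericPoint.exists_regularCell (hgen : GeneralPosition w) {l₀ : Fin d → ℝ}
    (hl₀ : ∀ i, 0 < l₀ ⬝ᵥ w i) (hh : IsGenericHeight w h) {x : Fin d → ℝ}
    (hx : IsGenericPoint w x) {t₀ : Fin n → ℝ} (ht₀ : ∀ i, 0 ≤ t₀ i)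
    (htx₀ : ∑ i, t₀ i • w i = x) : ∃ T, IsRegularCell w h T ∧ x ∈ cellCone w T := by
  classical
  obtain ⟨t, ⟨ht, htx⟩, hmin⟩ := (isCompact_representations hl₀ x).exists_isMinOn
    ⟨t₀, ht₀, htx₀⟩ (f := fun t => h ⬝ᵥ t) (by fun_prop)
  have hcard : d ≤ (Finset.univ.filter fun i => t i ≠ 0).card := by
    by_contra! hlt
    exact hx _ t hlt (fun i hi => by simpa using hi) htx
  obtain ⟨T, hTS, hT⟩ := Finset.exists_subset_card_eq hcard
  have hpos : ∀ i ∈ T, 0 < t i := fun i hi =>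
    lt_of_le_of_ne (ht i) (Ne.symm (by simpa using hTS hi))
  obtain ⟨l, hl⟩ := hgen.exists_dotProduct_eq hT h
  have hne : ∀ j ∉ T, l ⬝ᵥ w j ≠ h j := fun j hj hlj => by
    have := hh l (insert j T) fun i hi => by
      rcases Finset.mem_insert.1 hi with rfl | hi
      · exact hlj
      · exact hl i hi
    rw [Finset.card_insert_of_notMem hj] at this
    omega
  have key : ∀ j ∉ T, l ⬝ᵥ w j ≤ h j ∧ t j = 0 := by
    intro j hj
    obtain ⟨c, hc, hcw⟩ := hgen.exists_sum_eq hT (w j)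
    -- This is the relation expressing `w j` in the basis `T`; its cost is the reduced cost of `j`.
    let g : Fin n → ℝ := Pi.single j 1 - c
    have hgw : ∑ i, g i • w i = 0 := by
      simp only [g, Pi.sub_apply, sub_smul, Finset.sum_sub_distrib, hcw]
      rw [Finset.sum_eq_single j] <;> simp +contextual
    have hgh : h ⬝ᵥ g = h j - l ⬝ᵥ w j := by
      simp only [g, dotProduct_sub, dotProduct_single_one]
      rw [← hcw, dotProduct_sum_smul]
      congr 1
      refine Finset.sum_congr rfl fun i _ => ?_
      by_cases hi : i ∈ T
      · rw [hl i hi, mul_comm]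
      · rw [hc i hi, zero_mul, mul_zero]
    have hle : ∀ s : ℝ, (∀ i, 0 ≤ t i + s * g i) → 0 ≤ s * (h j - l ⬝ᵥ w j) := by
      intro s hs
      have : h ⬝ᵥ t ≤ h ⬝ᵥ (t + s • g) := hmin ⟨hs, by
        simp only [Pi.add_apply, Pi.smul_apply, smul_eq_mul, add_smul, Finset.sum_add_distrib,
          mul_smul, ← Finset.smul_sum, hgw, htx, smul_zero, add_zero]⟩
      rw [dotProduct_add, dotProduct_smul, smul_eq_mul, hgh] at this
      linarith
    have hev : ∀ᶠ s in nhds (0 : ℝ), ∀ i, 0 < t i → 0 < t i + s * g i := by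
      rw [Filter.eventually_all]
      intro i
      by_cases hi : 0 < t i
      · have hcont : Continuous fun s : ℝ => t i + s * g i := by fun_prop
        have : ∀ᶠ s in nhds (0 : ℝ), 0 < t i + s * g i :=
          (hcont.tendsto 0).eventually_const_lt (by simpa using hi)
        filter_upwards [this] with s hs _ using hs
      · exact Filter.Eventually.of_forall fun s h => absurd h hi
    obtain ⟨ε, hε, hball⟩ := Metric.eventually_nhds_iff.1 hev
    -- Positive coefficients survive small steps. A zero coefficient at `i ≠ j` lies off `T`, where
    -- `g` vanishes; only `j` can restrict the sign of `s`.
    have hstep : ∀ s : ℝ, |s| < ε → (0 < t j ∨ 0 ≤ s) → ∀ i, 0 ≤ t i + s * g i := by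
      intro s hs hsj i
      rcases (ht i).eq_or_lt with hi | hi
      · by_cases hij : i = j
        · subst hij
          have hgi : g i = 1 := by simp [g, hc i hj]
          rcases hsj with h' | h'
          · exact absurd hi h'.ne
          · rw [hgi, ← hi]
            linarith
        · have hiT : i ∉ T := fun h' => (hpos i h').ne hi
          have hgi : g i = 0 := by simp [g, hc i hiT, hij]
          rw [hgi, ← hi]
          simp
      · exact (hball (by simpa using hs) i hi).le
    have habs : |ε / 2| < ε := by
      rw [abs_of_pos (by linarith)]
      linarith
    have h1 : l ⬝ᵥ w j ≤ h j := by
      have := hle (ε / 2) (hstep _ habs (Or.inr (by linarith)))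
      have := nonneg_of_mul_nonneg_right this (by linarith)
      linarith
    refine ⟨h1, ?_⟩
    by_contra h0
    have := hle (-(ε / 2)) (hstep _ (by rwa [abs_neg])
      (Or.inl (lt_of_le_of_ne (ht j) (Ne.symm h0))))
    have hlt : 0 < h j - l ⬝ᵥ w j := sub_pos.2 (lt_of_le_of_ne h1 (hne j hj))
    have := mul_pos (half_pos hε) hlt
    linarith
  exact ⟨T, ⟨hT, l, hl, fun j hj => lt_of_le_of_ne (key j hj).1 (hne j hj)⟩,
    t, ht, fun j hj => (key j hj).2, htx⟩

/-- Genericity makes all coefficients of `x` on `T` positive. Since `l' ≤ h` on the generators,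
strictly somewhere on `T \ T'`, it follows that `⟨l', x⟩ < ⟨l, x⟩`; exchanging the cells gives the
reverse. -/
theorem IsGenericPoint.regularCell_unique {x : Fin d → ℝ} (hx : IsGenericPoint w x)
    {T T' : Finset (Fin n)} (hT : IsRegularCell w h T) (hT' : IsRegularCell w h T')
    (hxT : x ∈ cellCone w T) (hxT' : x ∈ cellCone w T') : T = T' := by
  classical
  by_contra hne
  obtain ⟨hTc, l, hl, hlt⟩ := hT
  obtain ⟨hTc', l', hl', hlt'⟩ := hT'
  have key : ∀ {T T' : Finset (Fin n)} {l l' : Fin d → ℝ}, T ≠ T' → T.card = d → T'.card = d →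
      (∀ i ∈ T, l ⬝ᵥ w i = h i) → (∀ i ∈ T', l' ⬝ᵥ w i = h i) → (∀ i ∉ T', l' ⬝ᵥ w i < h i) →
      x ∈ cellCone w T → l' ⬝ᵥ x < l ⬝ᵥ x := by
    rintro T T' l l' hne hTc hTc' hl hl' hlt' ⟨c, hc0, hc, hcx⟩
    have hpos : ∀ i ∈ T, 0 < c i := by
      intro i hi
      refine lt_of_le_of_ne (hc0 i) fun h0 => ?_
      refine hx (T.erase i) c (by rw [← hTc]; exact Finset.card_erase_lt_of_mem hi)
        (fun k hk => ?_) hcx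
      by_cases hki : k = i
      · rw [hki, ← h0]
      · exact hc k fun h' => hk (Finset.mem_erase.2 ⟨hki, h'⟩)
    have hex : ∃ i ∈ T, i ∉ T' := by
      by_contra! hsub
      exact hne (Finset.eq_of_subset_of_card_le hsub (by omega))
    have hle : ∀ i, l' ⬝ᵥ w i ≤ h i := fun i => by
      by_cases hi : i ∈ T'
      · exact (hl' i hi).le
      · exact (hlt' i hi).le
    have hterm : ∀ i, c i * (l ⬝ᵥ w i) = c i * h i := fun i => by
      by_cases hi : i ∈ T
      · rw [hl i hi]
      · rw [hc i hi, zero_mul, zero_mul]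
    rw [← hcx, dotProduct_sum_smul, dotProduct_sum_smul]
    obtain ⟨i, hiT, hiT'⟩ := hex
    refine Finset.sum_lt_sum (fun k _ => ?_) ⟨i, Finset.mem_univ i, ?_⟩
    · rw [hterm]
      exact mul_le_mul_of_nonneg_left (hle k) (hc0 k)
    · rw [hterm]
      exact mul_lt_mul_of_pos_left (hlt' i hiT') (hpos i hiT)
  exact lt_asymm (key hne hTc hTc' hl hl' hlt' hxT) (key (Ne.symm hne) hTc' hTc hl' hl hlt hxT')

end Triangulation

/-! ### The numerator and its values at the points `D*` -/

section Numerator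

open MvPolynomial

variable {w : Fin n → Fin d → ℝ} {h : Fin n → ℝ}

/-- `|det (w_i)_{i ∈ T}|` for a set `T` of `d` generators. -/
def cellVolume (w : Fin n → Fin d → ℝ) (T : Finset (Fin n)) : ℝ :=
  if hT : T.card = d then |Matrix.det (Matrix.of fun k => w (T.orderEmbOfFin hT k))| else 0

theorem abs_det_eq_of_range_eq {f g : Fin d → Fin n} (hf : Function.Injective f)
    (hg : Function.Injective g) (hfg : Set.range f = Set.range g) :
    |Matrix.det (Matrix.of fun k => w (f k))| = |Matrix.det (Matrix.of fun k => w (g k))| := by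
  let σ : Equiv.Perm (Fin d) := (Equiv.ofInjective f hf).trans
    ((Equiv.setCongr hfg).trans (Equiv.ofInjective g hg).symm)
  have hσ : ∀ k, g (σ k) = f k := fun k => by
    simp [σ, Equiv.apply_ofInjective_symm]
  have : (Matrix.of fun k => w (f k)) = (Matrix.of fun k => w (g k)).submatrix σ id := by
    ext i j
    simp [hσ]
  rw [this, Matrix.det_permute, abs_mul]
  rcases Int.units_eq_one_or (Equiv.Perm.sign σ) with h | h <;> simp [h]

theorem cellVolume_eq {f : Fin d → Fin n} (hf : Function.Injective f) :
    cellVolume w (Finset.univ.image f) = |Matrix.det (Matrix.of fun k => w (f k))| := by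
  have hT : (Finset.univ.image f).card = d := by
    rw [Finset.card_image_of_injective _ hf]
    simp
  rw [cellVolume, dif_pos hT]
  exact abs_det_eq_of_range_eq (Finset.orderEmbOfFin _ hT).injective hf (by simp)

theorem cellVolume_insert (hd : 1 ≤ d) (D : Diagonal d n) {k : Fin n} (hk : k ∉ D.1) :
    cellVolume w (insert k D.1) = |D.dual w ⬝ᵥ w k| := by
  rw [← D.image_append hd, cellVolume_eq (D.append_injective hk),
    D.dual_dotProduct_generator w hd]

open Classical in
/-- The maximal cells of the regular triangulation. -/
def regularCells (w : Fin n → Fin d → ℝ) (h : Fin n → ℝ) : Finset (Finset (Fin n)) :=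
  Finset.univ.filter (IsRegularCell w h)

theorem mem_regularCells {T : Finset (Fin n)} : T ∈ regularCells w h ↔ IsRegularCell w h T := by
  simp [regularCells]

/-- The numerator of the Fourier transform, as a sum over the cells of a triangulation. -/
def numerator (w : Fin n → Fin d → ℝ) (h : Fin n → ℝ) : MvPolynomial (Fin d) ℝ :=
  ∑ T ∈ regularCells w h, C (cellVolume w T) * ∏ i ∈ Tᶜ, linearForm (w i)

theorem numerator_isHomogeneous : (numerator w h).IsHomogeneous (n - d) :=
  IsHomogeneous.sum _ _ _ fun T hT => by
    have h1 := prod_linearForm_isHomogeneous w Tᶜ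
    rw [Finset.card_compl, (mem_regularCells.1 hT).1, Fintype.card_fin] at h1
    simpa using (isHomogeneous_C _ (cellVolume w T)).mul h1

open Classical in
/-- The numerator at `D*` is the sum over the cells that contain `D`. -/
theorem eval_numerator (hd : 1 ≤ d) (D : Diagonal d n) :
    eval (D.dual w) (numerator w h) =
      (∑ k ∈ D.1ᶜ.filter (fun k => IsRegularCell w h (insert k D.1)),
        (SignType.sign (D.dual w ⬝ᵥ w k) : ℝ)) * ∏ i ∈ D.1ᶜ, D.dual w ⬝ᵥ w i := by
  set E := D.1ᶜ.filter (fun k => IsRegularCell w h (insert k D.1)) with hE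
  have hE' : ∀ k ∈ E, k ∉ D.1 ∧ IsRegularCell w h (insert k D.1) := fun k hk => by
    simpa [hE] using hk
  have hinj : Set.InjOn (fun k => insert k D.1) E := by
    intro k hk m hm hkm
    exact (Finset.insert_inj (hE' k hk).1).1 hkm
  simp only [numerator, map_sum, map_mul, map_prod, eval_C, eval_linearForm]
  rw [Finset.sum_mul, ← Finset.sum_subset (s₁ := E.image fun k => insert k D.1)]
  · rw [Finset.sum_image hinj]
    refine Finset.sum_congr rfl fun k hk => ?_
    have hkD := (hE' k hk).1
    -- The volume is `|a| = sign a * a` for `a = ⟨D*, w k⟩`, which supplies the factor missing from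
    -- the product over `D.1ᶜ`.
    rw [cellVolume_insert hd D hkD, Finset.compl_insert,
      ← Finset.mul_prod_erase D.1ᶜ _ (Finset.mem_compl.2 hkD), ← mul_assoc, sign_mul_self]
  · intro T hT
    obtain ⟨k, hk, rfl⟩ := Finset.mem_image.1 hT
    exact mem_regularCells.2 (hE' k hk).2
  · intro T hT hTE
    have hTreg := mem_regularCells.1 hT
    -- A cell not containing `D` omits some `i ∈ D`, whose linear form vanishes at `D*`.
    have hsub : ¬ D.1 ⊆ T := by
      intro hsub
      obtain ⟨k, hkT, hkD⟩ := Finset.exists_mem_notMem_of_card_lt_card (s := D.1) (t := T)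
        (by rw [D.2, hTreg.1]; omega)
      have hTk : insert k D.1 = T :=
        Finset.eq_of_subset_of_card_le (Finset.insert_subset hkT hsub)
          (by rw [hTreg.1, D.card_insert hd hkD])
      exact hTE (Finset.mem_image.2 ⟨k, by simp [hE, hkD, hTk, hTreg], hTk⟩)
    obtain ⟨i, hiD, hiT⟩ := Finset.not_subset.1 hsub
    rw [Finset.prod_eq_zero (Finset.mem_compl.2 hiT) (D.dual_dotProduct_mem w hd hiD), mul_zero]

/-- The cells that contain `D` are the ends of an interval. -/
theorem isRegularCell_insert_iff (hgen : GeneralPosition w) (hd : 1 ≤ d) (hn : d ≤ n)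
    (D : Diagonal d n) {l₀ : Fin d → ℝ} (hl₀ : ∀ i ∈ D.1, l₀ ⬝ᵥ w i = h i) {k : Fin n}
    (hk : k ∉ D.1) : IsRegularCell w h (insert k D.1) ↔
      IsEnd D.1ᶜ (fun j => D.dual w ⬝ᵥ w j) (fun j => h j - l₀ ⬝ᵥ w j) k := by
  have hak := D.dual_dotProduct_ne_zero hgen hd hk
  constructor
  · rintro ⟨-, l, hl, hlt⟩
    refine ⟨Finset.mem_compl.2 hk, fun j hj hjk => ?_⟩
    -- The functional of the cell agrees with `l₀` on `D`, so it is `l₀ + s • D*`; tightness at `k`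
    -- determines `s`.
    obtain ⟨s, hs⟩ := D.eq_smul_dual hgen hd hn (l := l - l₀) fun i hi => by
      rw [sub_dotProduct, hl i (Finset.mem_insert_of_mem hi), hl₀ i hi, sub_self]
    have hs' : ∀ j, s * (D.dual w ⬝ᵥ w j) = l ⬝ᵥ w j - l₀ ⬝ᵥ w j := fun j => by
      rw [← sub_dotProduct, hs, smul_dotProduct, smul_eq_mul]
    have h1 := hs' k
    rw [hl k (Finset.mem_insert_self _ _)] at h1
    beta_reduce
    rw [← h1, mul_div_cancel_right₀ _ hak, hs']
    have := hlt j (by simp [hjk]; simpa using hj)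
    linarith
  · rintro ⟨-, hend⟩
    refine ⟨D.card_insert hd hk, l₀ + ((h k - l₀ ⬝ᵥ w k) / (D.dual w ⬝ᵥ w k)) • D.dual w,
      fun i hi => ?_, fun j hj => ?_⟩
    · rw [add_dotProduct, smul_dotProduct, smul_eq_mul]
      rcases Finset.mem_insert.1 hi with rfl | hi
      · rw [div_mul_cancel₀ _ hak]
        ring
      · rw [D.dual_dotProduct_mem w hd hi, hl₀ i hi]
        ring
    · rw [Finset.mem_insert, not_or] at hj
      have := hend j (Finset.mem_compl.2 hj.2) hj.1
      rw [add_dotProduct, smul_dotProduct, smul_eq_mul]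
      linarith

theorem isInterpolationData_numerator (v : Fin d → ℝ) (hgen : GeneralPosition w) (hd : 1 ≤ d)
    (hn : d ≤ n) (hh : IsGenericHeight w h) :
    IsInterpolationData v w fun D => eval (D.dual w) (numerator w h) := by
  classical
  intro D
  obtain ⟨j₀, hj₀⟩ := D.exists_notMem hd hn
  -- Only the values on `D` matter; `j₀` just completes a basis.
  obtain ⟨l₀, hl₀⟩ := hgen.exists_dotProduct_eq (D.card_insert hd hj₀) h
  have hl₀ : ∀ i ∈ D.1, l₀ ⬝ᵥ w i = h i := fun i hi => hl₀ i (Finset.mem_insert_of_mem hi)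
  have hJ : D.1ᶜ.Nonempty := ⟨j₀, Finset.mem_compl.2 hj₀⟩
  have hE : ∀ k, k ∈ D.1ᶜ.filter (fun k => IsRegularCell w h (insert k D.1)) ↔
      IsEnd D.1ᶜ (fun j => D.dual w ⬝ᵥ w j) (fun j => h j - l₀ ⬝ᵥ w j) k := by
    intro k
    rw [Finset.mem_filter]
    constructor
    · rintro ⟨hk, hreg⟩
      exact (isRegularCell_insert_iff hgen hd hn D hl₀ (Finset.mem_compl.1 hk)).1 hreg
    · intro hk
      exact ⟨hk.1, (isRegularCell_insert_iff hgen hd hn D hl₀ (Finset.mem_compl.1 hk.1)).2 hk⟩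
  have hne : ∀ j ∈ D.1ᶜ, D.dual w ⬝ᵥ w j ≠ 0 := fun j hj =>
    D.dual_dotProduct_ne_zero hgen hd (Finset.mem_compl.1 hj)
  -- Two constraints tight at the same `s` would give a functional equal to `h` on `d + 1`
  -- generators.
  have hsep : ∀ s : ℝ, ∀ j ∈ D.1ᶜ, ∀ k ∈ D.1ᶜ, s * (D.dual w ⬝ᵥ w j) = h j - l₀ ⬝ᵥ w j →
      s * (D.dual w ⬝ᵥ w k) = h k - l₀ ⬝ᵥ w k → j = k := by
    intro s j hj k hk hsj hsk
    by_contra hjk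
    have := hh (l₀ + s • D.dual w) (insert j (insert k D.1)) fun i hi => by
      rw [add_dotProduct, smul_dotProduct, smul_eq_mul]
      rcases Finset.mem_insert.1 hi with rfl | hi
      · linarith
      rcases Finset.mem_insert.1 hi with rfl | hi
      · linarith
      · rw [hl₀ i hi, D.dual_dotProduct_mem w hd hi]
        ring
    rw [Finset.card_insert_of_notMem (by simp [hjk]; simpa using hj),
      D.card_insert hd (Finset.mem_compl.1 hk)] at this
    omega
  beta_reduce
  rw [eval_numerator hd, D.isExtremal_iff hgen hd hn]
  constructor
  · rintro hext j hj
    simp only [← D.dual_dotProduct w hd]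
    congr 1
    rcases hext with hext | hext
    · have hpos : ∀ j ∈ D.1ᶜ, 0 < D.dual w ⬝ᵥ w j := fun j hj =>
        lt_of_le_of_ne (hext j) (hne j hj).symm
      rw [sum_sign_of_pos hE hsep hJ hpos, sign_pos (hpos j (Finset.mem_compl.2 hj))]
      simp
    · have hneg : ∀ j ∈ D.1ᶜ, D.dual w ⬝ᵥ w j < 0 := fun j hj =>
        lt_of_le_of_ne (hext j) (hne j hj)
      rw [sum_sign_of_neg hE hsep hJ hneg, sign_neg (hneg j (Finset.mem_compl.2 hj))]
      simp
  · intro hint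
    push Not at hint
    obtain ⟨⟨j, hj⟩, k, hk⟩ := hint
    have hmem : ∀ j, D.dual w ⬝ᵥ w j ≠ 0 → j ∈ D.1ᶜ := fun j hj =>
      Finset.mem_compl.2 fun h => hj (D.dual_dotProduct_mem w hd h)
    rw [sum_sign_of_pos_of_neg hE hsep hne ⟨k, hmem k hk.ne', hk⟩ ⟨j, hmem j hj.ne, hj⟩, zero_mul]

end Numerator

/-! ### The Fourier integral over the cells and uniqueness of the numerator -/

section FourierTransform

open MeasureTheory

variable {w : Fin n → Fin d → ℝ} {h : Fin n → ℝ} {ζ : Fin d → ℂ}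

theorem character_add (ζ : Fin d → ℂ) (x y : Fin d → ℝ) :
    character ζ (x + y) = character ζ x * character ζ y := by
  simp only [character, pairing, ← Complex.exp_add, ← mul_add, ← Finset.sum_add_distrib]
  simp [add_mul]

theorem character_sum_smul {m : ℕ} (ζ : Fin d → ℂ) (u : Fin m → Fin d → ℝ) (t : Fin m → ℝ) :
    character ζ (∑ k, t k • u k) =
      ∏ k, Complex.exp (2 * Real.pi * Complex.I * pairing (u k) ζ * t k) := by
  have : pairing (∑ k, t k • u k) ζ = ∑ k, pairing (u k) ζ * t k := by
    simp only [pairing, Finset.sum_apply, Pi.smul_apply, smul_eq_mul, Complex.ofReal_sum,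
      Complex.ofReal_mul, Finset.sum_mul]
    rw [Finset.sum_comm]
    exact Finset.sum_congr rfl fun k _ => Finset.sum_congr rfl fun i _ => by ring
  rw [character, this, ← Complex.exp_sum, Finset.mul_sum]
  simp only [mul_assoc]

theorem pairing_ne_zero (hζ : ζ ∈ tube w) (i : Fin n) : pairing (w i) ζ ≠ 0 := fun h0 => by
  have := hζ i
  simp [h0] at this

/-- The parametrization of a simplicial cone by the coefficients of its points. -/
def cellMap (v : Fin d → ℝ) (w : Fin n → Fin d → ℝ) (f : Fin d → Fin n) (t : Fin d → ℝ) :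
    Fin d → ℝ := v + Fintype.linearCombination ℝ (fun k => w (f k)) t

theorem cellMap_eq (v : Fin d → ℝ) (w : Fin n → Fin d → ℝ) (f : Fin d → Fin n) (t : Fin d → ℝ) :
    cellMap v w f t = v + ∑ k, t k • w (f k) := rfl

theorem image_cellMap (v : Fin d → ℝ) {f : Fin d → Fin n} (hf : Function.Injective f) :
    cellMap v w f '' (Set.univ.pi fun _ => Set.Ici 0) =
      {x | x - v ∈ cellCone w (Finset.univ.image f)} := by
  have hsum : ∀ c : Fin n → ℝ, (∀ i ∉ Finset.univ.image f, c i = 0) →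
      ∑ i, c i • w i = ∑ k, c (f k) • w (f k) := fun c hc => by
    rw [← Finset.sum_image (f := fun i => c i • w i) (hf.injOn)]
    exact (Finset.sum_subset (Finset.subset_univ _) fun i _ hi => by simp [hc i hi]).symm
  ext x
  constructor
  · rintro ⟨t, ht, rfl⟩
    have h0 : ∀ i ∉ Finset.univ.image f, Function.extend f t 0 i = 0 := fun i hi => by
      rw [Function.extend_apply' _ _ _ (by simpa using hi)]
      rfl
    refine ⟨Function.extend f t 0, fun i => ?_, h0, ?_⟩
    · by_cases hi : ∃ k, f k = i
      · obtain ⟨k, rfl⟩ := hi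
        rw [hf.extend_apply]
        exact ht k trivial
      · rw [Function.extend_apply' _ _ _ hi]
        rfl
    · rw [hsum _ h0, cellMap_eq, add_sub_cancel_left]
      simp only [hf.extend_apply]
  · rintro ⟨c, hc0, hc, hcx⟩
    refine ⟨fun k => c (f k), fun k _ => hc0 _, ?_⟩
    rw [cellMap_eq, ← hsum c hc, hcx, add_sub_cancel]

theorem hasFDerivAt_cellMap (v : Fin d → ℝ) (f : Fin d → Fin n) (t : Fin d → ℝ) :
    HasFDerivAt (cellMap v w f)
      (Fintype.linearCombination ℝ (fun k => w (f k))).toContinuousLinearMap t :=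
  (Fintype.linearCombination ℝ (fun k => w (f k))).toContinuousLinearMap.hasFDerivAt.const_add v

theorem det_linearCombination (u : Fin d → Fin d → ℝ) :
    (Fintype.linearCombination ℝ u).toContinuousLinearMap.det = Matrix.det (Matrix.of u) := by
  have : Fintype.linearCombination ℝ u = Matrix.toLin' (Matrix.of u)ᵀ := by
    ext i j
    simp [Fintype.linearCombination_apply_single]
  rw [ContinuousLinearMap.det, LinearMap.coe_toContinuousLinearMap, this, LinearMap.det_toLin',
    Matrix.det_transpose]

theorem cellMap_injective (hgen : GeneralPosition w) (v : Fin d → ℝ) {f : Fin d → Fin n}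
    (hf : Function.Injective f) : Function.Injective (cellMap v w f) := by
  intro s t hst
  have h1 : Fintype.linearCombination ℝ (fun k => w (f k)) s =
      Fintype.linearCombination ℝ (fun k => w (f k)) t := add_left_cancel hst
  exact LinearIndependent.fintypeLinearCombination_injective
    (linearIndependent_comp_of_injective hgen hf) h1

theorem measurableSet_orthant : MeasurableSet (Set.univ.pi fun _ : Fin d => Set.Ici (0 : ℝ)) :=
  MeasurableSet.univ_pi fun _ => measurableSet_Ici

theorem re_exponent_neg {p : ℂ} (hp : 0 < p.im) : (2 * Real.pi * Complex.I * p).re < 0 := by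
  have : (2 * Real.pi * Complex.I * p).re = -(2 * Real.pi * p.im) := by simp
  rw [this]
  have := Real.pi_pos
  nlinarith [mul_pos this hp]

theorem integral_exponent {p : ℂ} (hp : 0 < p.im) :
    ∫ t in Set.Ici (0 : ℝ), Complex.exp (2 * Real.pi * Complex.I * p * t) =
      Complex.I / (2 * Real.pi) / p := by
  rw [integral_Ici_eq_integral_Ioi, integral_exp_mul_complex_Ioi (re_exponent_neg hp)]
  have hp0 : p ≠ 0 := fun h => by simp [h] at hp
  have hπ : (Real.pi : ℂ) ≠ 0 := Complex.ofReal_ne_zero.2 Real.pi_ne_zero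
  have hI := Complex.I_ne_zero
  simp only [Complex.ofReal_zero, mul_zero, Complex.exp_zero]
  field_simp
  simp

/-- The Fourier transform of a simplicial cone. -/
theorem fourier_cellMap (hgen : GeneralPosition w) (v : Fin d → ℝ) {f : Fin d → Fin n}
    (hf : Function.Injective f) (hζ : ζ ∈ tube w) :
    MeasurableSet (cellMap v w f '' (Set.univ.pi fun _ => Set.Ici 0)) ∧
    IntegrableOn (character ζ) (cellMap v w f '' (Set.univ.pi fun _ => Set.Ici 0)) ∧
    ∫ x in cellMap v w f '' (Set.univ.pi fun _ => Set.Ici 0), character ζ x =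
      (|Matrix.det (Matrix.of fun k => w (f k))| : ℝ) *
        (∏ k, Complex.I / (2 * Real.pi) / pairing (w (f k)) ζ) * character ζ v := by
  have hderiv := fun t (_ : t ∈ Set.univ.pi fun _ : Fin d => Set.Ici (0 : ℝ)) =>
    (hasFDerivAt_cellMap (w := w) v f t).hasFDerivWithinAt
      (s := Set.univ.pi fun _ : Fin d => Set.Ici (0 : ℝ))
  have hinj := (cellMap_injective hgen v hf).injOn (s := Set.univ.pi fun _ => Set.Ici 0)
  -- In the coefficient coordinates the character splits into one-variable exponentials, so the
  -- integral factors.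
  have hchar : ∀ t, character ζ (cellMap v w f t) = character ζ v *
      ∏ k, Complex.exp (2 * Real.pi * Complex.I * pairing (w (f k)) ζ * t k) := fun t => by
    rw [cellMap_eq, character_add, character_sum_smul]
  have hint : ∀ k, Integrable
      (fun t : ℝ => Complex.exp (2 * Real.pi * Complex.I * pairing (w (f k)) ζ * t))
      (volume.restrict (Set.Ici 0)) := fun k => by
    exact (integrableOn_Ici_iff_integrableOn_Ioi (by simp)).2
      (integrableOn_exp_mul_complex_Ioi (re_exponent_neg (hζ (f k))) 0)
  refine ⟨measurable_image_of_fderivWithin measurableSet_orthant hderiv hinj, ?_, ?_⟩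
  · rw [integrableOn_image_iff_integrableOn_abs_det_fderiv_smul volume measurableSet_orthant
      hderiv hinj]
    simp only [hchar, det_linearCombination]
    refine Integrable.smul _ (Integrable.const_mul ?_ _)
    rw [volume_pi, Measure.restrict_pi_pi]
    exact Integrable.fintype_prod hint
  · rw [integral_image_eq_integral_abs_det_fderiv_smul volume measurableSet_orthant hderiv hinj]
    simp only [hchar, det_linearCombination]
    rw [integral_smul, integral_const_mul, volume_pi, Measure.restrict_pi_pi,
      integral_fintype_prod_eq_prod (fun k (t : ℝ) =>
        Complex.exp (2 * Real.pi * Complex.I * pairing (w (f k)) ζ * t))]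
    simp only [integral_exponent (hζ _), Complex.real_smul]
    ring

/-- The exceptional set is a finite union of proper subspaces, each of measure zero. -/
theorem ae_isGenericPoint (w : Fin n → Fin d → ℝ) :
    ∀ᵐ x : Fin d → ℝ, IsGenericPoint w x := by
  have hS : ∀ S : Finset (Fin n), ∀ᵐ x : Fin d → ℝ, S.card < d →
      x ∉ Submodule.span ℝ (Set.range fun i : S => w i) := by
    intro S
    by_cases hS : S.card < d
    · have hne : Submodule.span ℝ (Set.range fun i : S => w i) ≠ ⊤ := by
        intro htop
        have h1 := finrank_range_le_card (R := ℝ) (fun i : S => w i)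
        rw [Set.finrank, htop] at h1
        simp only [finrank_top, Module.finrank_fintype_fun_eq_card, Fintype.card_fin,
          Fintype.card_coe] at h1
        omega
      have h0 := Measure.addHaar_submodule (volume : Measure (Fin d → ℝ)) _ hne
      filter_upwards [measure_eq_zero_iff_ae_notMem.1 h0] with x hx _ using hx
    · exact Filter.Eventually.of_forall fun x h => absurd h hS
  filter_upwards [ae_all_iff.2 hS] with x hx S c hcard hc hcx
  refine hx S hcard ?_
  rw [← hcx, sum_smul_eq_sum_subtype hc]
  exact Submodule.sum_mem _ fun i _ => Submodule.smul_mem _ _ (Submodule.subset_span ⟨i, rfl⟩)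

theorem ae_isGenericPoint_sub (w : Fin n → Fin d → ℝ) (v : Fin d → ℝ) :
    ∀ᵐ x : Fin d → ℝ, IsGenericPoint w (x - v) :=
  (measurePreserving_sub_right volume v).quasiMeasurePreserving.ae (ae_isGenericPoint w)

/-- Up to null sets, the cone is the union of the cells of a regular triangulation. -/
theorem cone_ae_eq_iUnion (hgen : GeneralPosition w) {l₀ : Fin d → ℝ}
    (hl₀ : ∀ i, 0 < l₀ ⬝ᵥ w i) (hh : IsGenericHeight w h) (v : Fin d → ℝ) :
    cone v w =ᵐ[volume] ⋃ T : regularCells w h, {x | x - v ∈ cellCone w T.1} := by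
  rw [Filter.eventuallyEq_set]
  filter_upwards [ae_isGenericPoint_sub w v] with x hx
  rw [Set.mem_iUnion]
  constructor
  · rintro ⟨t, ht, rfl⟩
    obtain ⟨T, hT, hxT⟩ := hx.exists_regularCell hgen hl₀ hh ht (by simp)
    exact ⟨⟨T, mem_regularCells.2 hT⟩, hxT⟩
  · rintro ⟨T, c, hc0, -, hcx⟩
    exact ⟨c, hc0, by rw [hcx]; simp⟩

/-- The Fourier transform of one cell of a triangulation. -/
theorem fourier_cellCone (hgen : GeneralPosition w) (v : Fin d → ℝ) {T : Finset (Fin n)}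
    (hT : T.card = d) (hζ : ζ ∈ tube w) :
    MeasurableSet {x | x - v ∈ cellCone w T} ∧
    IntegrableOn (character ζ) {x | x - v ∈ cellCone w T} ∧
    ∫ x in {x | x - v ∈ cellCone w T}, character ζ x =
      (Complex.I / (2 * Real.pi)) ^ d *
        ((cellVolume w T * ∏ i ∈ Tᶜ, pairing (w i) ζ) / ∏ i, pairing (w i) ζ) *
        character ζ v := by
  have hf := (T.orderEmbOfFin hT).injective
  have himage : Finset.univ.image (T.orderEmbOfFin hT) = T := by simp
  have key := fourier_cellMap hgen v hf hζ
  rw [image_cellMap v hf, ← cellVolume_eq hf, himage] at key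
  refine ⟨key.1, key.2.1, key.2.2.trans ?_⟩
  have hprod : ∏ k, Complex.I / (2 * Real.pi) / pairing (w (T.orderEmbOfFin hT k)) ζ =
      (Complex.I / (2 * Real.pi)) ^ d / ∏ i ∈ T, pairing (w i) ζ := by
    rw [Finset.prod_div_distrib, Finset.prod_const, Finset.card_univ, Fintype.card_fin]
    congr 1
    conv_rhs => rw [← himage]
    rw [Finset.prod_image hf.injOn]
  have h1 : ∏ i ∈ T, pairing (w i) ζ ≠ 0 :=
    Finset.prod_ne_zero_iff.2 fun i _ => pairing_ne_zero hζ i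
  have h2 : ∏ i ∈ Tᶜ, pairing (w i) ζ ≠ 0 :=
    Finset.prod_ne_zero_iff.2 fun i _ => pairing_ne_zero hζ i
  rw [hprod, ← Finset.prod_mul_prod_compl T fun i => pairing (w i) ζ]
  field_simp

theorem isFourierNumerator_numerator (hgen : GeneralPosition w) {l₀ : Fin d → ℝ}
    (hl₀ : ∀ i, 0 < l₀ ⬝ᵥ w i) (hh : IsGenericHeight w h) (v : Fin d → ℝ) :
    IsFourierNumerator v w (numerator w h) := by
  refine ⟨numerator_isHomogeneous, fun ζ hζ => ?_⟩
  have hcell := fun T : regularCells w h =>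
    fourier_cellCone hgen v (mem_regularCells.1 T.2).1 hζ
  have hae := cone_ae_eq_iUnion hgen hl₀ hh v
  have hint : IntegrableOn (character ζ)
      (⋃ T : regularCells w h, {x | x - v ∈ cellCone w T.1}) :=
    integrableOn_finite_iUnion.2 fun T => (hcell T).2.1
  refine ⟨hint.congr_set_ae hae, ?_⟩
  rw [fourierIndicator, setIntegral_congr_set hae,
    integral_iUnion_ae (fun T => (hcell T).1.nullMeasurableSet) ?_ hint, tsum_fintype]
  · simp only [(hcell _).2.2]
    rw [← Finset.sum_mul, ← Finset.mul_sum, ← Finset.sum_div]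
    congr 3
    rw [numerator, map_sum, Finset.sum_coe_sort (regularCells w h)
      (fun T => (cellVolume w T : ℂ) * ∏ i ∈ Tᶜ, pairing (w i) ζ)]
    simp [aeval_linearForm]
  · intro T T' hne
    have hnull := ae_iff.1 (ae_isGenericPoint_sub w v)
    -- Two distinct cells share no generic point, so their overlap is null.
    refine measure_mono_null (fun x hx => ?_) hnull
    refine fun hgx => hne ?_
    exact Subtype.ext (IsGenericPoint.regularCell_unique hgx (mem_regularCells.1 T.2) (mem_regularCells.1 T'.2)
      hx.1 hx.2)

open MvPolynomial in
theorem aeval_mul_ofReal {k : ℕ} {q : MvPolynomial (Fin d) ℝ} (hq : q.IsHomogeneous k) (c : ℂ)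
    (ξ : Fin d → ℝ) : aeval (fun i => c * (ξ i : ℂ)) q = c ^ k * (eval ξ q : ℝ) := by
  rw [aeval_def, eval₂_eq', eval_eq', Complex.ofReal_sum, Finset.mul_sum]
  refine Finset.sum_congr rfl fun e he => ?_
  have hdeg := hq (mem_support_iff.1 he)
  rw [Finsupp.weight_apply, Finsupp.sum_fintype _ _ (by simp)] at hdeg
  have hdeg : ∑ i, e i = k := by simpa using hdeg
  simp only [mul_pow, Finset.prod_mul_distrib, Finset.prod_pow_eq_pow_sum, hdeg]
  push_cast
  simp only [Complex.coe_algebraMap]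
  ring

open MvPolynomial in
-- At `ζ = iξ`, with `ξ` positive on all generators, the formula determines the value of the
-- numerator at `ξ`. These `ξ` form a nonempty open set, which contains a product of infinite sets.
theorem IsFourierNumerator.unique {v l₀ : Fin d → ℝ} (hl₀ : ∀ i, 0 < l₀ ⬝ᵥ w i)
    {p q : MvPolynomial (Fin d) ℝ} (hp : IsFourierNumerator v w p)
    (hq : IsFourierNumerator v w q) : p = q := by
  have heval : ∀ ξ : Fin d → ℝ, (∀ i, 0 < ξ ⬝ᵥ w i) → eval ξ p = eval ξ q := by
    intro ξ hξ
    have hpair : ∀ u : Fin d → ℝ, pairing u (fun i => Complex.I * (ξ i : ℂ)) =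
        Complex.I * ((ξ ⬝ᵥ u : ℝ) : ℂ) := fun u => by
      simp only [pairing, dotProduct, Complex.ofReal_sum, Finset.mul_sum, Complex.ofReal_mul]
      exact Finset.sum_congr rfl fun i _ => by ring
    have hζ : (fun i => Complex.I * (ξ i : ℂ)) ∈ tube w := fun i => by
      rw [hpair]
      simpa using hξ i
    have h1 := (hp.2 _ hζ).2.symm.trans (hq.2 _ hζ).2
    have hπ : (Real.pi : ℂ) ≠ 0 := Complex.ofReal_ne_zero.2 Real.pi_ne_zero
    have hc : (Complex.I / (2 * Real.pi)) ^ d ≠ 0 :=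
      pow_ne_zero _ (div_ne_zero Complex.I_ne_zero (mul_ne_zero two_ne_zero hπ))
    have h2 := mul_left_cancel₀ hc (mul_right_cancel₀ (Complex.exp_ne_zero _) h1)
    have h3 : ∏ i, pairing (w i) (fun i => Complex.I * (ξ i : ℂ)) ≠ 0 :=
      Finset.prod_ne_zero_iff.2 fun i _ => pairing_ne_zero hζ i
    rw [div_left_inj' h3, aeval_mul_ofReal hp.1, aeval_mul_ofReal hq.1] at h2
    exact Complex.ofReal_injective (mul_left_cancel₀ (pow_ne_zero _ Complex.I_ne_zero) h2)
  have hopen : IsOpen {ξ : Fin d → ℝ | ∀ i, 0 < ξ ⬝ᵥ w i} := by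
    simp only [Set.ofPred_forall]
    exact isOpen_iInter_of_finite fun i => isOpen_lt continuous_const
      (by unfold dotProduct; fun_prop)
  obtain ⟨u, hu, hsub⟩ := isOpen_pi_iff'.1 hopen l₀ hl₀
  exact funext_set u (fun i => infinite_of_mem_nhds (l₀ i) ((hu i).1.mem_nhds (hu i).2))
    fun ξ hξ => heval ξ (hsub hξ)

end FourierTransform

end ConicFourier

end

theorem mainTheorem3 (d n : ℕ) (hd : 1 ≤ d) (hn : d ≤ n)
    (v : Fin d → ℝ) (w : Fin n → Fin d → ℝ)
    (hline : ConicFourier.ContainsNoLine (ConicFourier.cone v w))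
    (hgen : ConicFourier.GeneralPosition w) :
    ConicFourier.IsConeOverSimplicialPolytope v (ConicFourier.cone v w) ∧
    Fintype.card (ConicFourier.Diagonal d n) = n.choose (d - 1) ∧
    Fintype.card (ConicFourier.Exponent d (n - d)) = (n - 1).choose (d - 1) ∧
    (ConicFourier.interpolationMatrix w).rank = (n - 1).choose (d - 1) ∧
    ∃ p : MvPolynomial (Fin d) ℝ,
      (∀ q : MvPolynomial (Fin d) ℝ, ConicFourier.IsFourierNumerator v w q ↔ q = p) ∧
      ∃ b : ConicFourier.Diagonal d n → ℝ, ConicFourier.IsInterpolationData v w b ∧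
        (∀ x : ConicFourier.Exponent d (n - d) → ℝ,
          (ConicFourier.interpolationMatrix w).mulVec x = b ↔ x = fun e => p.coeff e.1) ∧
        ∀ q : MvPolynomial (Fin d) ℝ, q.IsHomogeneous (n - d) →
          ((∀ D : ConicFourier.Diagonal d n, MvPolynomial.eval (D.dual w) q = b D) ↔ q = p) := by
  obtain ⟨l, hl⟩ := hline.exists_dotProduct_pos (hgen.ne_zero hd hn)
  -- The choice is immaterial: by uniqueness all generic heights give the same numerator.
  obtain ⟨h, hh⟩ := ConicFourier.exists_isGenericHeight hgen
  have hp := ConicFourier.isFourierNumerator_numerator hgen hl hh v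
  have hA : (ConicFourier.interpolationMatrix w).mulVec
      (fun e => (ConicFourier.numerator w h).coeff e.1) =
      fun D => MvPolynomial.eval (D.dual w) (ConicFourier.numerator w h) :=
    funext fun D => ConicFourier.interpolationMatrix_mulVec_coeff w hp.1 D
  refine ⟨ConicFourier.isConeOverSimplicialPolytope_cone v hgen hd hn hl,
    ConicFourier.card_diagonal, ConicFourier.card_exponent hd hn,
    ConicFourier.rank_interpolationMatrix hgen hd hn, ConicFourier.numerator w h, fun q => ?_, _,
    ConicFourier.isInterpolationData_numerator v hgen hd hn hh, fun x => ?_, fun q hq => ?_⟩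
  · constructor
    · exact fun hq => hq.unique hl hp
    · rintro rfl
      exact hp
  · rw [← hA]
    exact (ConicFourier.interpolationMatrix_injective hgen hd hn).eq_iff
  · constructor
    · exact fun hqD => ConicFourier.eq_of_eval_dual_eq hgen hd hn hq hp.1 hqD
    · rintro rfl D
      rfl
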